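/- Let $k$ be an algebraically closed field of characteristic $p>0$, let $q=p^e$ with $e\ge 1$, and let $X\subset\mathbb P^3$ be a smooth extremal surface of degree $q+1$ over $k$, that is, a smooth surface defined by a Frobenius form: a homogeneous polynomial $F\in k[x,y,z,w]$ of degree $q+1$ lying in the ideal $\langle x^q,y^q,z^q,w^q\rangle$. Let $\mathrm{Aut}(X)$ be the group of projective linear automorphisms of $X$, i.e. the subgroup of all elements of $\mathrm{PGL}(4,k)$ that map $X$ onto itself. Then: (1) $\mathrm{Aut}(X)$ acts transitively on the set of ordered triples of pairwise skew lines on $X$: if $(L_1,L_2,L_3)$ and $(L_1',L_2',L_3')$ are two such triples, there is $g\in\mathrm{Aut}(X)$ with $g(L_i)=L_i'$ for $i=1,2,3$. (2) Let $\mathcal S$ be the set of ordered sextuples $(L_1,L_2,L_3,M_1,M_2,M_3)$ of lines on $X$ such that $L_1,L_2,L_3$ are pairwise skew, $M_1,M_2,M_3$ are pairwise skew, and $L_i\cap M_j\neq\emptyset$ for all $i,j$. Then $\mathcal S$ is nonempty and $\mathrm{Aut}(X)$ acts simply transitively on it: for any two elements of $\mathcal S$ there is exactly one $g\in\mathrm{Aut}(X)$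 mapping the first to the second, entry by entry. -/

import Mathlib

open scoped LinearAlgebra.Projectivization MatrixGroups Pointwise

/-- A form `F` of degree `q + 1` in `n` variables is a *Frobenius form* if it lies in the ideal
`⟨x₁^q, …, xₙ^q⟩`. Here `q` is a positive power of the characteristic of `k`. -/
def IsFrobeniusForm {k : Type*} [Field k] {n : ℕ} (q : ℕ) (F : MvPolynomial (Fin n) k) : Prop :=
  F.IsHomogeneous (q + 1) ∧
    F ∈ Ideal.span (Set.range fun i : Fin n => (MvPolynomial.X i : MvPolynomial (Fin n) k) ^ q)

/-- The Jacobian criterion for smoothness of the projective hypersurface `F = 0`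
(over an algebraically closed field): at each of its points some partial derivative of `F`
is nonzero. -/
def IsSmoothForm {k : Type*} [Field k] {n : ℕ} (F : MvPolynomial (Fin n) k) : Prop :=
  ∀ v : Fin n → k, v ≠ 0 → MvPolynomial.eval v F = 0 →
    ∃ i, MvPolynomial.eval v (MvPolynomial.pderiv i F) ≠ 0

/-- The projective hypersurface `F = 0`, as the set of its points: those lines through the origin
on which `F` vanishes. -/
def projZeroLocus {k : Type*} [Field k] {n : ℕ} (F : MvPolynomial (Fin n) k) :
    Set (ℙ k (Fin n → k)) :=
  {P | ∀ v ∈ P.submodule, MvPolynomial.eval v F = 0}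

/-- A smooth extremal surface of degree `q + 1` in `ℙ³`: a smooth surface defined by a
Frobenius form. -/
def IsSmoothExtremalSurface {k : Type*} [Field k] (q : ℕ) (X : Set (ℙ k (Fin 4 → k))) : Prop :=
  ∃ F : MvPolynomial (Fin 4) k, IsFrobeniusForm q F ∧ IsSmoothForm F ∧ X = projZeroLocus F

/-- The group `Aut(X)` of projective linear automorphisms of `X ⊆ ℙ³`: the subgroup of `PGL(4, k)`
of all elements that map `X` onto itself. -/
def projAut {k : Type*} [Field k] (X : Set (ℙ k (Fin 4 → k))) : Subgroup PGL(4, k) :=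
  MulAction.stabilizer PGL(4, k) X

/-- A line in `ℙ³`: the set of points of the projectivization of a plane in `k⁴`. -/
def IsProjLine {k : Type*} [Field k] (L : Set (ℙ k (Fin 4 → k))) : Prop :=
  ∃ W : Submodule k (Fin 4 → k), Module.finrank k W = 2 ∧ L = {P | P.submodule ≤ W}

/-- `(L 0, L 1, L 2)` is an (ordered) triple of pairwise skew lines on `X`. -/
structure IsSkewTriple {k : Type*} [Field k] (X : Set (ℙ k (Fin 4 → k)))
    (L : Fin 3 → Set (ℙ k (Fin 4 → k))) : Prop where
  isLine : ∀ i, IsProjLine (L i)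
  subset : ∀ i, L i ⊆ X
  skew : ∀ i j, i ≠ j → Disjoint (L i) (L j)

/-- `(L 0, L 1, L 2, M 0, M 1, M 2)` is an ordered sextuple of lines on `X` that consists of two
triples of skew lines such that every line of the first meets every line of the second. -/
structure IsSkewSextuple {k : Type*} [Field k] (X : Set (ℙ k (Fin 4 → k)))
    (L M : Fin 3 → Set (ℙ k (Fin 4 → k))) : Prop where
  left : IsSkewTriple X L
  right : IsSkewTriple X M
  meet : ∀ i j, (L i ∩ M j).Nonempty

/-! The equation of `X` is `F(v) = B(v, v)`, where `B` is `q`-Frobenius-semilinear in its first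
argument and linear in the second. Since the derivative of `x^q` vanishes, the gradient of `F` at
`v` is `B(v, ·)`, so smoothness makes `B` nondegenerate. A line lies on `X` exactly when its plane
is totally isotropic for `B`.

Simple transitivity on sextuples: the six planes have a normal form in a basis of `k⁴`
(`exists_basis_skewPlanes`), and their isotropy determines the Gram matrix of `B` in that basis up
to a scalar (`exists_gram_eq_of_isTotallyIsotropic`). The change of basis between two sextuples
therefore multiplies `B` by a nonzero scalar and induces an automorphism of `X`. It is unique
because a linear map preserving all six planes is a homothety (`exists_smul_of_map_skewPlanes_le`).

Transitivity on triples follows once every triple extends to a sextuple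
(`exists_transversal_planes`). The third plane is the graph of an isomorphism between the first two,
which turns `B` into a nondegenerate form on a plane; three of its isotropic vectors give the
transversals.

It remains to find one skew triple. Lang's theorem, applied to the `q²`-semilinear map `φ` with
`B(w, φ v) = B(v, w)^q`, yields a spanning set of vectors on which `B` is Hermitian. Hence `k⁴`
splits into two orthogonal nondegenerate planes, and isotropic vectors in each, suitably scaled,
form a basis with the Gram matrix above. -/

open Polynomial in
theorem IsAlgClosed.exists_eval_eq_zero_of_coeff_ne_zero {k : Type*} [Field k] [IsAlgClosed k]
    {P : k[X]} {n : ℕ} (hn : n ≠ 0) (h : P.coeff n ≠ 0) : ∃ x, P.eval x = 0 := by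
  refine IsAlgClosed.exists_root P fun h0 => h ?_
  rw [eq_C_of_degree_eq_zero h0, coeff_C, if_neg hn]

/-! ### Fixed vectors of Frobenius-semilinear maps -/

section Lang

variable {k : Type*} [Field k]

open Polynomial in
/-- The polynomials `c₀ = a₀ X ^ q`, `cᵢ₊₁ = cᵢ ^ q + aᵢ₊₁ X ^ q` that arise by successive
elimination from the equation `φ x = x` for a Frobenius-semilinear map in companion form. -/
noncomputable def langPoly (q : ℕ) (a : ℕ → k) : ℕ → k[X]
  | 0 => C (a 0) * X ^ q
  | i + 1 => langPoly q a i ^ q + C (a (i + 1)) * X ^ q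

open Polynomial in
theorem X_sq_dvd_langPoly {q : ℕ} (hq : 2 ≤ q) (a : ℕ → k) (i : ℕ) : X ^ 2 ∣ langPoly q a i := by
  have hX : (X : k[X]) ^ 2 ∣ X ^ q := pow_dvd_pow _ hq
  induction i with
  | zero => exact hX.mul_left _
  | succ i ih => exact dvd_add (ih.trans (dvd_pow_self _ (by omega))) (hX.mul_left _)

-- The term `P_n ^ q` is divisible by `X ^ (2q)`, so the coefficient of `X ^ q` in `P_{n+1}` is
-- `a_{n+1}` alone; once it vanishes, so does `P_n`.
open Polynomial in
theorem eq_zero_of_langPoly_eq_zero {q : ℕ} (hq : 2 ≤ q) (a : ℕ → k) (n : ℕ) (h : langPoly q a n = 0) :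
    ∀ i ≤ n, a i = 0 := by
  induction n with
  | zero =>
    intro i hi
    obtain rfl : i = 0 := by omega
    simpa [langPoly] using h
  | succ n ih =>
    have hn : a (n + 1) = 0 := by
      have h1 := congrArg (fun P : k[X] => P.coeff q) h
      obtain ⟨d, hd⟩ := X_sq_dvd_langPoly hq a n
      have h2 : (langPoly q a n ^ q).coeff q = 0 := by
        rw [hd, mul_pow, ← pow_mul, coeff_X_pow_mul', if_neg (by omega)]
      simpa [langPoly, h2] using h1
    have h3 : langPoly q a n = 0 := by
      have h4 : langPoly q a n ^ q = 0 := by simpa [langPoly, hn] using h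
      exact eq_zero_of_pow_eq_zero h4
    intro i hi
    rcases Nat.lt_or_ge i (n + 1) with hlt | hge
    · exact ih h3 i (by omega)
    · rwa [show i = n + 1 by omega]

open Polynomial in
theorem exists_langPoly_eval_eq [IsAlgClosed k] {q : ℕ} (hq : 2 ≤ q) (a : ℕ → k) (n : ℕ)
    (h : ∃ i ≤ n, a i ≠ 0) : ∃ y ≠ 0, (langPoly q a n).eval y = y := by
  obtain ⟨d, hd⟩ := X_sq_dvd_langPoly hq a n
  have hd0 : d ≠ 0 := by
    rintro rfl
    obtain ⟨i, hi, hne⟩ := h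
    exact hne (eq_zero_of_langPoly_eq_zero hq a n (by simpa using hd) i hi)
  -- As `P_n = X² d`, the nonzero solutions of `P_n(y) = y` are the roots of `X d - 1`, which is
  -- nonconstant because `d ≠ 0`.
  have hc : (X * d - 1).coeff (d.natDegree + 1) ≠ 0 := by
    simp [coeff_one, hd0]
  obtain ⟨y, hy⟩ := IsAlgClosed.exists_eval_eq_zero_of_coeff_ne_zero (Nat.succ_ne_zero _) hc
  have hy' : y * d.eval y = 1 := by simpa [sub_eq_zero] using hy
  refine ⟨y, left_ne_zero_of_mul_eq_one hy', ?_⟩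
  rw [hd]
  simp only [eval_mul, eval_pow, eval_X]
  linear_combination y * hy'

variable [IsAlgClosed k] {V : Type*} [AddCommGroup V] [Module k V] [FiniteDimensional k V]
  {τ : k →+* k} {q : ℕ}

/-- On the span of the iterates of one vector, `φ` is in companion form. Comparing coefficients in
`φ x = x` expresses all of them through the last one, `y`, and leaves a single polynomial equation
for `y`. -/
theorem exists_ne_zero_map_eq_self [Nontrivial V] (hq : 2 ≤ q) (hτ : ∀ x, τ x = x ^ q)
    (φ : V →ₛₗ[τ] V) (hφ : Function.Injective φ) : ∃ x ≠ 0, φ x = x := by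
  obtain ⟨v, hv⟩ := exists_ne (0 : V)
  set f : ℕ → V := fun i => φ^[i] v with hf
  have hfs : ∀ i, φ (f i) = f (i + 1) := fun i => (Function.iterate_succ_apply' φ i v).symm
  have hf0 : ∀ i, f i ≠ 0 := by
    intro i
    induction i with
    | zero => exact hv
    | succ i ih => rw [← hfs]; exact (map_ne_zero_iff φ hφ).2 ih
  let S : ℕ →o Submodule k V :=
    ⟨fun n => Submodule.span k (f '' (Finset.range n : Finset ℕ)), fun m n h =>
      Submodule.span_mono (Set.image_mono (by simpa using h))⟩
  have hex : ∃ n, f n ∈ S n := by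
    obtain ⟨n, hn⟩ := monotone_stabilizes_iff_noetherian.2 (inferInstance : IsNoetherian k V) S
    refine ⟨n, ?_⟩
    rw [hn (n + 1) (by omega)]
    exact Submodule.subset_span ⟨n, by simp, rfl⟩
  classical
  -- Minimality keeps the last iterate before the relation out of the span of its predecessors, so a
  -- combination with last coefficient `y ≠ 0` cannot vanish.
  obtain ⟨n, hn, hmin⟩ : ∃ n, f n ∈ S n ∧ ∀ m < n, f m ∉ S m :=
    ⟨Nat.find hex, Nat.find_spec hex, fun m hm => Nat.find_min hex hm⟩
  obtain ⟨a, ha⟩ : ∃ a : ℕ → k, ∑ i ∈ Finset.range n, a i • f i = f n := by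
    obtain ⟨a, ha⟩ := Submodule.mem_span_image_finset_iff_exists_fun k |>.1 hn
    refine ⟨fun i => if h : i ∈ Finset.range n then a ⟨i, h⟩ else 0, ?_⟩
    rw [← ha, ← Finset.sum_coe_sort]
    exact Finset.sum_congr rfl fun i _ => by simp only [i.2, dite_true]
  obtain _ | n := n
  · exact absurd (by simpa using ha.symm) (hf0 0)
  have hane : ∃ i ≤ n, a i ≠ 0 := by
    by_contra! h
    refine hf0 (n + 1) (ha.symm.trans (Finset.sum_eq_zero fun i hi => ?_))
    rw [h i (by simpa [Nat.lt_succ_iff] using hi), zero_smul]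
  obtain ⟨y, hy0, hy⟩ := exists_langPoly_eval_eq hq a n hane
  set c : ℕ → k := fun i => (langPoly q a i).eval y
  refine ⟨∑ i ∈ Finset.range (n + 1), c i • f i, fun h0 => ?_, ?_⟩
  · rw [Finset.sum_range_succ] at h0
    refine hmin n (by omega) ?_
    have h1 : c n • f n ∈ S n := by
      rw [eq_neg_of_add_eq_zero_right h0]
      exact neg_mem (sum_mem fun i hi => Submodule.smul_mem _ _ (Submodule.subset_span ⟨i, hi, rfl⟩))
    rw [show c n = y from hy] at h1
    exact (Submodule.smul_mem_iff _ hy0).1 h1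
  · have hc0 : c 0 = a 0 * y ^ q := by simp [c, langPoly]
    have hcs : ∀ i, c (i + 1) = c i ^ q + a (i + 1) * y ^ q := by intro i; simp [c, langPoly]
    have h1 : φ (∑ i ∈ Finset.range (n + 1), c i • f i) =
        ∑ i ∈ Finset.range n, c i ^ q • f (i + 1) + y ^ q • f (n + 1) := by
      simp only [map_sum, map_smulₛₗ, hτ, hfs]
      rw [Finset.sum_range_succ, show c n = y from hy]
    rw [h1, ← ha, Finset.sum_range_succ' (fun i => a i • f i), Finset.sum_range_succ', hc0]
    simp only [hcs, add_smul, mul_smul, Finset.sum_add_distrib, Finset.smul_sum, smul_add]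
    simp only [smul_comm (y ^ q)]
    abel

/-- **Lang's theorem** for Frobenius-semilinear maps: the fixed vectors of an injective
Frobenius-semilinear endomorphism of a finite-dimensional space span the space. -/
theorem span_map_eq_self_eq_top (hq : 2 ≤ q) (hτ : ∀ x, τ x = x ^ q)
    (φ : V →ₛₗ[τ] V) (hφ : Function.Injective φ) : Submodule.span k {x | φ x = x} = ⊤ := by
  set S := Submodule.span k {x | φ x = x} with hS
  -- `φ` maps `S` onto itself because scalars have `q`-th roots; with injectivity of `φ`, this makes
  -- the induced map on `V ⧸ S` injective.
  have key : ∀ s ∈ S, ∃ t ∈ S, φ t = s := by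
    intro s hs
    induction hs using Submodule.span_induction with
    | mem x hx => exact ⟨x, Submodule.subset_span hx, hx⟩
    | zero => exact ⟨0, zero_mem _, map_zero _⟩
    | add x y _ _ hx hy =>
      obtain ⟨x', hx', rfl⟩ := hx
      obtain ⟨y', hy', rfl⟩ := hy
      exact ⟨x' + y', add_mem hx' hy', map_add _ _ _⟩
    | smul c x _ hx =>
      obtain ⟨x', hx', rfl⟩ := hx
      obtain ⟨d, rfl⟩ := IsAlgClosed.exists_pow_nat_eq c (show 0 < q by omega)
      exact ⟨d • x', S.smul_mem d hx', by rw [map_smulₛₗ, hτ]⟩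
  -- On a multiple of a fixed vector this is the Artin–Schreier type equation `d - d ^ q = c`; such
  -- multiples generate `S` additively.
  have key2 : ∀ s ∈ S, ∃ t ∈ S, t - φ t = s := by
    intro s hs
    induction hs using Submodule.closure_induction with
    | zero => exact ⟨0, zero_mem _, by simp⟩
    | add x y _ _ hx hy =>
      obtain ⟨x', hx', rfl⟩ := hx
      obtain ⟨y', hy', rfl⟩ := hy
      exact ⟨x' + y', add_mem hx' hy', by rw [map_add]; abel⟩
    | smul_mem c x hx =>
      obtain ⟨d, hd⟩ : ∃ d : k, d - d ^ q = c := by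
        have hc : (Polynomial.X ^ q - Polynomial.X + Polynomial.C c).coeff q ≠ 0 := by
          simp [Polynomial.coeff_X, Polynomial.coeff_C, show q ≠ 0 by omega, show 1 ≠ q by omega]
        obtain ⟨d, hd⟩ := IsAlgClosed.exists_eval_eq_zero_of_coeff_ne_zero (by omega) hc
        refine ⟨d, ?_⟩
        simp only [Polynomial.eval_add, Polynomial.eval_sub, Polynomial.eval_pow,
          Polynomial.eval_X, Polynomial.eval_C] at hd
        linear_combination -hd
      refine ⟨d • x, S.smul_mem d (Submodule.subset_span hx), ?_⟩
      rw [map_smulₛₗ, hτ, show φ x = x from hx, ← sub_smul, hd]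
  by_contra hne
  have hle : S ≤ S.comap φ := by
    rw [hS, Submodule.span_le]
    intro x hx
    have hx' : φ x = x := hx
    simpa [hx'] using Submodule.subset_span hx
  have : Nontrivial (V ⧸ S) := Submodule.Quotient.nontrivial_iff.2 hne
  obtain ⟨x, hx0, hx⟩ := exists_ne_zero_map_eq_self hq hτ (S.mapQ S φ hle) (by
    rw [injective_iff_map_eq_zero]
    intro x hx
    obtain ⟨x, rfl⟩ := S.mkQ_surjective x
    rw [Submodule.mkQ_apply] at hx ⊢
    rw [Submodule.mapQ_apply, Submodule.Quotient.mk_eq_zero] at hx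
    obtain ⟨t, ht, htx⟩ := key _ hx
    rw [Submodule.Quotient.mk_eq_zero, ← hφ htx]
    exact ht)
  obtain ⟨x, rfl⟩ := S.mkQ_surjective x
  rw [Submodule.mkQ_apply, Submodule.mapQ_apply, Submodule.Quotient.eq] at hx
  obtain ⟨t, ht, hts⟩ := key2 _ hx
  refine hx0 ((Submodule.Quotient.mk_eq_zero S).2 ?_)
  -- A fixed class in the quotient is corrected by `t ∈ S` to a genuine fixed vector, which forces
  -- the class to be zero.
  have hxt : x + t ∈ S := Submodule.subset_span (by
    change φ (x + t) = x + t
    rw [map_add, ← sub_eq_zero]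
    rw [← sub_eq_zero] at hts
    rw [← neg_eq_zero, ← hts]
    abel)
  exact (Submodule.add_mem_iff_left _ ht).1 hxt

end Lang

/-! ### Isotropic vectors and orthogonal splitting of Frobenius forms -/

section Forms

variable {k : Type*} [Field k] [IsAlgClosed k] {σ : k →+* k} {q : ℕ}
  {V : Type*} [AddCommGroup V] [Module k V]

/-- A nondegenerate Frobenius-sesquilinear form on a plane has three pairwise independent
isotropic vectors, which can be scaled to be of the form `a`, `b`, `a + b`. -/
theorem exists_isotropic_triple (hq : 2 ≤ q) (hσ : ∀ x, σ x = x ^ q) (B : V →ₛₗ[σ] V →ₗ[k] k)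
    (hV : Module.finrank k V = 2) (hB : ∀ v, (∀ w, B v w = 0) → v = 0) :
    ∃ a b, LinearIndependent k ![a, b] ∧ B a a = 0 ∧ B b b = 0 ∧ B (a + b) (a + b) = 0 := by
  have : FiniteDimensional k V := Module.finite_of_finrank_pos (by omega)
  let e := Module.finBasisOfFinrankEq k V hV
  obtain ⟨a, ha0, ha⟩ : ∃ a ≠ 0, B a a = 0 := by
    by_cases h : B (e 1) (e 1) = 0
    · exact ⟨e 1, e.ne_zero 1, h⟩
    obtain ⟨t, ht⟩ := IsAlgClosed.exists_eval_eq_zero_of_coeff_ne_zero (n := q + 1)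
      (P := .C (B (e 1) (e 1)) * .X ^ (q + 1) + .C (B (e 1) (e 0)) * .X ^ q +
        .C (B (e 0) (e 1)) * .X + .C (B (e 0) (e 0))) (by omega) (by
        simpa [Polynomial.coeff_X, Polynomial.coeff_C, show q ≠ 0 by omega] using h)
    refine ⟨e 0 + t • e 1, fun h0 => ?_, ?_⟩
    · have h1 := congrArg (fun v => e.repr v 0) h0
      simp at h1
    · simp only [Polynomial.eval_add, Polynomial.eval_mul, Polynomial.eval_pow,
        Polynomial.eval_X, Polynomial.eval_C] at ht
      simp only [map_add, map_smulₛₗ, LinearMap.add_apply, LinearMap.smul_apply, hσ, smul_eq_mul,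
        RingHom.id_apply]
      linear_combination ht
  obtain ⟨c, hc⟩ : ∃ c, LinearIndependent k ![a, c] := by
    by_contra! h
    have : Module.finrank k V ≤ 1 := finrank_le_one a fun w => by
      have := h w
      rw [LinearIndependent.pair_iff' ha0] at this
      simpa using this
    omega
  have hspan : ∀ {c : V}, LinearIndependent k ![a, c] → ∀ w, ∃ x y : k, w = x • a + y • c := by
    intro c hc w
    have h := hc.span_eq_top_of_card_eq_finrank (by simp [hV])
    have hw : w ∈ Submodule.span k (Set.range ![a, c]) := h ▸ Submodule.mem_top
    rw [Matrix.range_cons, Matrix.range_cons, Matrix.range_empty, Set.union_empty,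
      Set.singleton_union, Submodule.mem_span_pair] at hw
    obtain ⟨x, y, rfl⟩ := hw
    exact ⟨x, y, rfl⟩
  have hac : ∀ {c : V}, LinearIndependent k ![a, c] → B a c ≠ 0 := by
    intro c hc h
    refine ha0 (hB a fun w => ?_)
    obtain ⟨x, y, rfl⟩ := hspan hc w
    simp [ha, h]
  obtain ⟨t, ht⟩ := IsAlgClosed.exists_eval_eq_zero_of_coeff_ne_zero (n := q)
    (P := .C (B a c) * .X ^ q + .C (B c a) * .X + .C (B c c)) (by omega) (by
      simpa [Polynomial.coeff_X, Polynomial.coeff_C, show q ≠ 0 by omega,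
        show 1 ≠ q by omega] using hac hc)
  set b := t • a + c with hb
  have hbb : B b b = 0 := by
    simp only [Polynomial.eval_add, Polynomial.eval_mul, Polynomial.eval_pow,
      Polynomial.eval_X, Polynomial.eval_C] at ht
    simp only [hb, map_add, map_smulₛₗ, LinearMap.add_apply, LinearMap.smul_apply, hσ, smul_eq_mul,
      RingHom.id_apply, ha]
    linear_combination ht
  have hab : LinearIndependent k ![a, b] := by
    rw [LinearIndependent.pair_iff] at hc ⊢
    intro x y hxy
    have := hc (x + y * t) y (by rw [← hxy, hb]; module)
    refine ⟨?_, this.2⟩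
    simpa [this.2] using this.1
  have hba : B b a ≠ 0 := by
    intro h
    refine hab.ne_zero 1 (hB b fun w => ?_)
    obtain ⟨x, y, rfl⟩ := hspan hab w
    simp [hbb, h]
  have h0 := hac hab
  -- For isotropic `a` and `b`, the vector `a + s b` is isotropic when `s B(a, b) + s ^ q B(b, a) =
  -- 0`.
  obtain ⟨s, hs⟩ := IsAlgClosed.exists_pow_nat_eq (-(B a b / B b a)) (show 0 < q - 1 by omega)
  have hs0 : s ≠ 0 := by
    rintro rfl
    rw [zero_pow (by omega), eq_comm, neg_eq_zero, div_eq_zero_iff] at hs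
    tauto
  have hsq : s ^ q = s * s ^ (q - 1) := by rw [← pow_succ']; congr 1; omega
  refine ⟨a, s • b, ?_, ha, by simp [hbb], ?_⟩
  · rw [LinearIndependent.pair_iff] at hab ⊢
    intro x y hxy
    have := hab x (y * s) (by rw [← hxy, mul_smul])
    simpa [hs0] using this
  · simp only [map_add, map_smulₛₗ, LinearMap.add_apply, LinearMap.smul_apply, hσ, smul_eq_mul,
      RingHom.id_apply, ha, hbb, hsq, hs]
    field_simp
    ring

omit [IsAlgClosed k] in
/-- The Frobenius-semilinear map `φ` with `B w (φ v) = σ (B v w)`. -/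
theorem exists_semilinear_adjoint [FiniteDimensional k V] (B : V →ₛₗ[σ] V →ₗ[k] k)
    (hl : ∀ v, (∀ w, B v w = 0) → v = 0) (hr : ∀ w, (∀ v, B v w = 0) → w = 0) :
    ∃ φ : V →ₛₗ[σ.comp σ] V, Function.Injective φ ∧ ∀ v w, B w (φ v) = σ (B v w) := by
  let e := Module.finBasis k V
  have hext : ∀ f g : V →ₛₗ[σ] k, (∀ i, f (e i) = g (e i)) → f = g := fun f g h => e.ext h
  let R : V →ₗ[k] (Fin (Module.finrank k V) → k) := LinearMap.pi fun i => B (e i)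
  have hR : Function.Injective R := by
    rw [injective_iff_map_eq_zero]
    intro z hz
    refine hr z fun v => ?_
    have : B.flip z = 0 := hext _ _ fun i => congrFun hz i
    exact LinearMap.congr_fun this v
  let E := LinearEquiv.ofInjectiveOfFinrankEq R hR (by simp)
  let ψ : V →ₛₗ[σ.comp σ] (Fin (Module.finrank k V) → k) :=
    { toFun := fun v i => σ (B v (e i))
      map_add' := fun v w => by ext; simp
      map_smul' := fun c v => by ext; simp }
  have hE : ∀ v w, B w (E.symm (ψ v)) = σ (B v w) := by
    intro v w
    let f : V →ₛₗ[σ] k :=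
      { toFun := fun w => σ (B v w)
        map_add' := by simp
        map_smul' := by simp }
    have : B.flip (E.symm (ψ v)) = f := hext _ _ fun i => congrFun (E.apply_symm_apply (ψ v)) i
    exact LinearMap.congr_fun this w
  refine ⟨E.symm.toLinearMap.comp ψ, ?_, hE⟩
  rw [injective_iff_map_eq_zero]
  intro v hv
  refine hl v fun w => σ.injective ?_
  rw [← hE v w, map_zero]
  exact (congrArg (B w) hv).trans (map_zero _)

/-- The vectors are sought among the fixed vectors of `φ`, which span `V`. If all their `2 × 2` Gram
determinants vanished, `B` would have rank at most one on them, against nondegeneracy in dimension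
at least two. -/
theorem exists_hermitian_pair [FiniteDimensional k V] (hq : 2 ≤ q) (hσ : ∀ x, σ x = x ^ q)
    (B : V →ₛₗ[σ] V →ₗ[k] k) (hV : 2 ≤ Module.finrank k V)
    (hl : ∀ v, (∀ w, B v w = 0) → v = 0) (hr : ∀ w, (∀ v, B v w = 0) → w = 0) :
    ∃ u v, (∀ w, B w u = σ (B u w)) ∧ (∀ w, B w v = σ (B v w)) ∧
      B u u * B v v - B u v * B v u ≠ 0 := by
  obtain ⟨φ, hφ, hBφ⟩ := exists_semilinear_adjoint B hl hr
  have htop := span_map_eq_self_eq_top (q := q * q) (by nlinarith)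
    (fun x => by rw [RingHom.comp_apply, hσ, hσ, ← pow_mul]) φ hφ
  have hfix : ∀ {u}, φ u = u → ∀ w, B w u = σ (B u w) := fun {u} hu w => by rw [← hBφ, hu]
  have hzero : ∀ v, (∀ w, φ w = w → B v w = 0) → v = 0 := fun v hv => hl v fun w =>
    LinearMap.congr_fun (LinearMap.ext_on (f := B v) (g := 0) htop hv) w
  by_contra! h
  replace h : ∀ {u v}, φ u = u → φ v = v → B u u * B v v = B u v * B v u := fun {u v} hu hv =>
    sub_eq_zero.1 (h u v (hfix hu) (hfix hv))
  have hmul : ∀ {u v}, φ u = u → B u v * B v u = 0 → B u v = 0 := by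
    intro u v hu huv
    rw [hfix hu v] at huv
    rcases mul_eq_zero.1 huv with h0 | h0
    · exact h0
    · exact (map_eq_zero σ).1 h0
  obtain ⟨u, hu, huu⟩ : ∃ u, φ u = u ∧ B u u ≠ 0 := by
    by_contra! h0
    have : Submodule.span k {x | φ x = x} ≤ ⊥ := Submodule.span_le.2 fun x hx =>
      hzero x fun w hw => hmul hx (by rw [← h hx hw, h0 x hx, zero_mul])
    rw [htop, top_le_iff] at this
    have h1 := finrank_top k V
    rw [← this, finrank_bot] at h1
    omega
  -- Values of `B` on fixed vectors are fixed by `σ²`, so orthogonal projection away from `u`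
  -- preserves fixed vectors.
  have hproj : ∀ v, φ v = v → φ (v - (B u v / B u u) • u) = v - (B u v / B u u) • u ∧
      B u (v - (B u v / B u u) • u) = 0 := by
    intro v hv
    have h1 : ∀ w, φ w = w → σ (σ (B u w)) = B u w := fun w hw => by
      rw [← hfix hu w, ← hfix hw u]
    refine ⟨?_, by simp [huu]⟩
    rw [map_sub, map_smulₛₗ, hu, hv, RingHom.comp_apply, map_div₀, map_div₀, h1 v hv, h1 u hu]
  have hself : ∀ v, φ v = v → B u v = 0 → B v v = 0 := by
    intro v hv huv
    have := h hu hv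
    rw [huv, zero_mul] at this
    exact (mul_eq_zero.1 this).resolve_left huu
  have hall : ∀ v, φ v = v → v = (B u v / B u u) • u := by
    intro v hv
    obtain ⟨h1, h2⟩ := hproj v hv
    rw [← sub_eq_zero]
    refine hzero _ fun w hw => ?_
    obtain ⟨h3, h4⟩ := hproj w hw
    have h5 := hmul (v := w - (B u w / B u u) • u) h1
      (by rw [← h h1 h3, hself _ h1 h2, zero_mul])
    have h6 : B (v - (B u v / B u u) • u) u = 0 := by rw [hfix hu, h2, map_zero]
    rw [map_sub, map_smul, h6, smul_zero, sub_zero] at h5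
    exact h5
  have hle : Submodule.span k {x | φ x = x} ≤ Submodule.span k {u} := Submodule.span_le.2
    fun x hx => Submodule.mem_span_singleton.2 ⟨_, (hall x hx).symm⟩
  rw [htop, top_le_iff] at hle
  have := finrank_span_singleton (K := k) (v := u) (by rintro rfl; simp at huu)
  rw [hle, finrank_top] at this
  omega

/-- The Hermitian relations make left and right orthogonality to `u` and `v` agree, so their span
`N` and its complement `N'` are orthogonal on both sides, and each inherits nondegeneracy. -/
theorem exists_hyperbolic_splitting (hq : 2 ≤ q) (hσ : ∀ x, σ x = x ^ q)
    (B : V →ₛₗ[σ] V →ₗ[k] k) (hV : Module.finrank k V = 4)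
    (hl : ∀ v, (∀ w, B v w = 0) → v = 0) (hr : ∀ w, (∀ v, B v w = 0) → w = 0) :
    ∃ a b c d, LinearIndependent k ![a, b, c, d] ∧ B a a = 0 ∧ B b b = 0 ∧ B c c = 0 ∧ B d d = 0 ∧
      B (a + b) (a + b) = 0 ∧ B (c + d) (c + d) = 0 ∧
      (∀ x ∈ ({a, b} : Set V), ∀ y ∈ ({c, d} : Set V), B x y = 0 ∧ B y x = 0) := by
  have : FiniteDimensional k V := Module.finite_of_finrank_pos (by omega)
  obtain ⟨u, v, hu, hv, hdet⟩ := exists_hermitian_pair hq hσ B (by omega) hl hr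
  set N := Submodule.span k {u, v} with hN
  set N' := (B u).ker ⊓ (B v).ker with hN'
  have hmemN : ∀ {n}, n ∈ N → ∃ x y : k, n = x • u + y • v := fun hn => by
    obtain ⟨x, y, h⟩ := Submodule.mem_span_pair.1 hn
    exact ⟨x, y, h.symm⟩
  have hnd : ∀ x y : k, B (x • u + y • v) u = 0 → B (x • u + y • v) v = 0 → x = 0 ∧ y = 0 := by
    intro x y h1 h2
    simp only [map_add, map_smulₛₗ, LinearMap.add_apply, LinearMap.smul_apply,
      smul_eq_mul] at h1 h2
    constructor
    · refine (map_eq_zero σ).1 ((mul_eq_zero.1 (?_ : σ x * _ = 0)).resolve_right hdet)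
      linear_combination B v v * h1 - B v u * h2
    · refine (map_eq_zero σ).1 ((mul_eq_zero.1 (?_ : σ y * _ = 0)).resolve_right hdet)
      linear_combination B u u * h2 - B u v * h1
  have huv : LinearIndependent k ![u, v] := by
    rw [LinearIndependent.pair_iff]
    intro x y h
    exact hnd x y (by simp [h]) (by simp [h])
  have hNN' : ∀ n ∈ N, ∀ w ∈ N', B n w = 0 ∧ B w n = 0 := by
    intro n hn w hw
    obtain ⟨x, y, rfl⟩ := hmemN hn
    have h1 : B u w = 0 := hw.1
    have h2 : B v w = 0 := hw.2
    simp [h1, h2, hu w, hv w]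
  have hdisj : Disjoint N N' := by
    rw [Submodule.disjoint_def]
    intro n hn hn'
    obtain ⟨x, y, rfl⟩ := hmemN hn
    obtain ⟨rfl, rfl⟩ := hnd x y
      (hNN' u (Submodule.subset_span (by simp)) _ hn').2
      (hNN' v (Submodule.subset_span (by simp)) _ hn').2
    simp
  have hcod : N ⊔ N' = ⊤ := by
    rw [eq_top_iff]
    intro w _
    set D := B u u * B v v - B u v * B v u with hD
    -- The orthogonal projection of `w` to `N`, by Cramer's rule.
    set n := ((B v v * B u w - B u v * B v w) / D) • u +
      ((B u u * B v w - B v u * B u w) / D) • v with hn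
    rw [← add_sub_cancel n w]
    refine Submodule.add_mem_sup (Submodule.mem_span_pair.2 ⟨_, _, rfl⟩) ⟨?_, ?_⟩ <;>
    · rw [SetLike.mem_coe, LinearMap.mem_ker, map_sub, hn, map_add, map_smul, map_smul,
        smul_eq_mul, smul_eq_mul]
      field_simp
      rw [hD]
      ring
  have hfN : Module.finrank k N = 2 := by
    have := finrank_span_eq_card huv
    rwa [Matrix.range_cons, Matrix.range_cons, Matrix.range_empty, Set.union_empty,
      Set.singleton_union, Fintype.card_fin] at this
  have hfN' : Module.finrank k N' = 2 := by
    have := Submodule.finrank_add_eq_of_isCompl ⟨hdisj, codisjoint_iff.2 hcod⟩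
    omega
  have hndN : ∀ x : N, (∀ y : N, B.domRestrict₁₂ N N x y = 0) → x = 0 := by
    rintro ⟨x, hx⟩ h
    refine Subtype.ext (hl x fun w => ?_)
    obtain ⟨n, hn, w', hw', rfl⟩ := Submodule.mem_sup.1 (hcod ▸ Submodule.mem_top : w ∈ N ⊔ N')
    rw [map_add, (hNN' x hx w' hw').1, add_zero]
    exact h ⟨n, hn⟩
  have hndN' : ∀ x : N', (∀ y : N', B.domRestrict₁₂ N' N' x y = 0) → x = 0 := by
    rintro ⟨x, hx⟩ h
    refine Subtype.ext (hl x fun w => ?_)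
    obtain ⟨n, hn, w', hw', rfl⟩ := Submodule.mem_sup.1 (hcod ▸ Submodule.mem_top : w ∈ N ⊔ N')
    rw [map_add, (hNN' n hn x hx).2, zero_add]
    exact h ⟨w', hw'⟩
  obtain ⟨a, b, hab, haa, hbb, hs⟩ := exists_isotropic_triple hq hσ _ hfN hndN
  obtain ⟨c, d, hcd, hcc, hdd, ht⟩ := exists_isotropic_triple hq hσ _ hfN' hndN'
  refine ⟨a, b, c, d, ?_, haa, hbb, hcc, hdd, hs, ht, ?_⟩
  · rw [LinearIndependent.pair_iff] at hab hcd
    rw [Fintype.linearIndependent_iff]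
    intro g hg
    simp only [Fin.sum_univ_four, Matrix.cons_val] at hg
    have h1 : g 0 • (a : V) + g 1 • (b : V) = -(g 2 • (c : V) + g 3 • (d : V)) := by
      rw [← sub_eq_zero, ← hg]
      abel
    have h2 : (g 0 • a + g 1 • b : N) = 0 := by
      have := Submodule.disjoint_def.1 hdisj _ (g 0 • a + g 1 • b : N).2 (by
        push_cast
        rw [h1]
        exact neg_mem (g 2 • c + g 3 • d : N').2)
      exact Subtype.ext this
    have h3 : (g 2 • c + g 3 • d : N') = 0 := by
      have h4 : (g 0 • a + g 1 • b : V) = 0 := by simpa using congrArg Subtype.val h2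
      rw [h4, eq_comm, neg_eq_zero] at h1
      exact Subtype.ext h1
    have h5 := hab _ _ h2
    have h6 := hcd _ _ h3
    intro i
    fin_cases i
    exacts [h5.1, h5.2, h6.1, h6.2]
  · rintro x (rfl | rfl) y (rfl | rfl)
    exacts [hNN' _ a.2 _ c.2, hNN' _ a.2 _ d.2, hNN' _ b.2 _ c.2, hNN' _ b.2 _ d.2]

end Forms

/-! ### Normal form of a `3 × 3` grid of lines -/

section SkewPlanes

variable {k : Type*} [Field k] {V : Type*} [AddCommGroup V] [Module k V]

/-- The planes of a bundle of three skew lines in normal form. -/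
def skewPlanes (u₁ u₂ w₁ w₂ : V) : Fin 3 → Submodule k V :=
  ![.span k {u₁, u₂}, .span k {w₁, w₂}, .span k {u₁ + w₁, u₂ + w₂}]

theorem linearIndependent_pair_of_disjoint {A B : Submodule k V} (h : Disjoint A B) {x y : V}
    (hx : x ∈ A) (hy : y ∈ B) (hx0 : x ≠ 0) (hy0 : y ≠ 0) : LinearIndependent k ![x, y] := by
  rw [LinearIndependent.pair_iff]
  intro s t hst
  have h1 : s • x = 0 := Submodule.disjoint_def.1 h _ (A.smul_mem s hx) (by
    rw [eq_neg_of_add_eq_zero_left hst]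
    exact neg_mem (B.smul_mem t hy))
  rw [h1, zero_add] at hst
  exact ⟨(smul_eq_zero.1 h1).resolve_right hx0, (smul_eq_zero.1 hst).resolve_right hy0⟩

theorem eq_span_pair_of_finrank_eq_two {W : Submodule k V} (hW : Module.finrank k W = 2) {x y : V}
    (hx : x ∈ W) (hy : y ∈ W) (h : LinearIndependent k ![x, y]) : W = .span k {x, y} := by
  have : FiniteDimensional k W := Module.finite_of_finrank_pos (by omega)
  refine (Submodule.eq_of_le_of_finrank_le (Submodule.span_le.2 ?_) ?_).symm
  · rintro z (rfl | rfl) <;> assumption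
  · have := finrank_span_eq_card h
    rw [Matrix.range_cons, Matrix.range_cons, Matrix.range_empty, Set.union_empty,
      Set.singleton_union, Fintype.card_fin] at this
    rw [this, hW]

theorem finrank_span_pair_of_linearIndependent {x y : V} (h : LinearIndependent k ![x, y]) :
    Module.finrank k (Submodule.span k {x, y}) = 2 := by
  have := finrank_span_eq_card h
  rwa [Matrix.range_cons, Matrix.range_cons, Matrix.range_empty, Set.union_empty,
    Set.singleton_union, Fintype.card_fin] at this

/-- Three distinct points on a line can be represented by vectors `x`, `y`, `x + y`, even with `x`
prescribed: only `y` is rescaled. -/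
theorem exists_span_pair_of_disjoint {W A B C : Submodule k V} (hW : Module.finrank k W = 2)
    (hAB : Disjoint A B) (hAC : Disjoint A C) (hBC : Disjoint B C) {x : V} (hxA : x ∈ A)
    (hxW : x ∈ W) (hx : x ≠ 0) (hB : B ⊓ W ≠ ⊥) (hC : C ⊓ W ≠ ⊥) :
    ∃ y, y ∈ B ∧ y ∈ W ∧ y ≠ 0 ∧ x + y ∈ C ∧ W = .span k {x, y} := by
  obtain ⟨y, ⟨hyB, hyW⟩, hy⟩ := Submodule.exists_mem_ne_zero_of_ne_bot hB
  obtain ⟨z, ⟨hzC, hzW⟩, hz⟩ := Submodule.exists_mem_ne_zero_of_ne_bot hC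
  have h := eq_span_pair_of_finrank_eq_two hW hxW hyW
    (linearIndependent_pair_of_disjoint hAB hxA hyB hx hy)
  have hz' := hzW
  rw [h] at hz'
  obtain ⟨s, t, hst⟩ := Submodule.mem_span_pair.1 hz'
  have hs : s ≠ 0 := by
    rintro rfl
    refine hz (Submodule.disjoint_def.1 hBC _ ?_ hzC)
    rw [← hst, zero_smul, zero_add]
    exact B.smul_mem t hyB
  have ht : t ≠ 0 := by
    rintro rfl
    refine hz (Submodule.disjoint_def.1 hAC _ ?_ hzC)
    rw [← hst, zero_smul, add_zero]
    exact A.smul_mem s hxA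
  have hc : s⁻¹ * t ≠ 0 := mul_ne_zero (inv_ne_zero hs) ht
  have hy' : (s⁻¹ * t) • y ≠ 0 := smul_ne_zero hc hy
  refine ⟨(s⁻¹ * t) • y, B.smul_mem _ hyB, W.smul_mem _ hyW, hy', ?_,
    eq_span_pair_of_finrank_eq_two hW hxW (W.smul_mem _ hyW)
      (linearIndependent_pair_of_disjoint hAB hxA (B.smul_mem _ hyB) hx hy')⟩
  have : x + (s⁻¹ * t) • y = s⁻¹ • z := by
    rw [← hst, smul_add, smul_smul, smul_smul, inv_mul_cancel₀ hs, one_smul]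
  rw [this]
  exact C.smul_mem _ hzC

/-- A `3 × 3` grid of lines in projective three-space has a normal form. -/
theorem exists_basis_skewPlanes (hV : Module.finrank k V = 4) {P Q : Fin 3 → Submodule k V}
    (hP : ∀ i, Module.finrank k (P i) = 2) (hP' : ∀ i j, i ≠ j → Disjoint (P i) (P j))
    (hQ : ∀ i, Module.finrank k (Q i) = 2) (hQ' : ∀ i j, i ≠ j → Disjoint (Q i) (Q j))
    (hPQ : ∀ i j, P i ⊓ Q j ≠ ⊥) :
    ∃ b : Module.Basis (Fin 4) k V, P = skewPlanes (b 0) (b 1) (b 2) (b 3) ∧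
      Q = skewPlanes (b 0) (b 2) (b 1) (b 3) := by
  have h01 : (0 : Fin 3) ≠ 1 := by decide
  have h02 : (0 : Fin 3) ≠ 2 := by decide
  have h12 : (1 : Fin 3) ≠ 2 := by decide
  have hQP : ∀ i j, Q j ⊓ P i ≠ ⊥ := fun i j => inf_comm (Q j) (P i) ▸ hPQ i j
  obtain ⟨x, ⟨hxP, hxQ⟩, hx⟩ := Submodule.exists_mem_ne_zero_of_ne_bot (hPQ 0 0)
  obtain ⟨y, hyQ, hyP, hy, hxy, hP0⟩ := exists_span_pair_of_disjoint (hP 0) (hQ' 0 1 h01)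
    (hQ' 0 2 h02) (hQ' 1 2 h12) hxQ hxP hx (hQP 0 1) (hQP 0 2)
  obtain ⟨z, hzP, hzQ, hz, hxz, hQ0⟩ := exists_span_pair_of_disjoint (hQ 0) (hP' 0 1 h01)
    (hP' 0 2 h02) (hP' 1 2 h12) hxP hxQ hx (hPQ 1 0) (hPQ 2 0)
  obtain ⟨w, hwP, hwQ, hw, hyw, hQ1⟩ := exists_span_pair_of_disjoint (hQ 1) (hP' 0 1 h01)
    (hP' 0 2 h02) (hP' 1 2 h12) hyP hyQ hy (hPQ 1 1) (hPQ 2 1)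
  have hne : ∀ {A B : Submodule k V}, Disjoint A B → ∀ {a b : V}, a ∈ A → b ∈ B → a ≠ 0 →
      a + b ≠ 0 := by
    intro A B h a b ha hb ha0 h0
    refine ha0 (Submodule.disjoint_def.1 h a ha ?_)
    rw [eq_neg_of_add_eq_zero_left h0]
    exact neg_mem hb
  obtain ⟨r, hrP, hrQ, hr, hxr, hQ2⟩ := exists_span_pair_of_disjoint (hQ 2) (hP' 0 1 h01)
    (hP' 0 2 h02) (hP' 1 2 h12) (add_mem hxP hyP) hxy (hne (hQ' 0 1 h01) hxQ hyQ hx)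
    (hPQ 1 2) (hPQ 2 2)
  have hxyl := linearIndependent_pair_of_disjoint (hQ' 0 1 h01) hxQ hyQ hx hy
  have hzwl := linearIndependent_pair_of_disjoint (hQ' 0 1 h01) hzQ hwQ hz hw
  have hP1 := eq_span_pair_of_finrank_eq_two (hP 1) hzP hwP hzwl
  have hP2 := eq_span_pair_of_finrank_eq_two (hP 2) hxz hyw
    (linearIndependent_pair_of_disjoint (hQ' 0 1 h01) (add_mem hxQ hzQ) (add_mem hyQ hwQ)
      (hne (hP' 0 1 h01) hxP hzP hx) (hne (hP' 0 1 h01) hyP hwP hy))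
  have hind : ∀ α β γ δ : k, α • x + β • y + γ • z + δ • w = 0 →
      α = 0 ∧ β = 0 ∧ γ = 0 ∧ δ = 0 := by
    intro α β γ δ h
    have h1 : α • x + β • y = -(γ • z + δ • w) := by
      rw [← sub_eq_zero, ← h]
      abel
    have h2 : α • x + β • y = 0 := by
      refine Submodule.disjoint_def.1 (hP' 0 1 h01) _
        (add_mem (Submodule.smul_mem _ _ hxP) (Submodule.smul_mem _ _ hyP)) ?_
      rw [h1]
      exact neg_mem (add_mem (Submodule.smul_mem _ _ hzP) (Submodule.smul_mem _ _ hwP))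
    rw [h2, eq_comm, neg_eq_zero] at h1
    obtain ⟨hα, hβ⟩ := LinearIndependent.pair_iff.1 hxyl _ _ h2
    obtain ⟨hγ, hδ⟩ := LinearIndependent.pair_iff.1 hzwl _ _ h1
    exact ⟨hα, hβ, hγ, hδ⟩
  -- The third transversal is forced: `x + y + r` lies in the span of `x + z` and `y + w`, and its
  -- `x` and `y` coordinates are both 1.
  have hr' : r = z + w := by
    rw [hP1] at hrP
    rw [hP2] at hxr
    obtain ⟨s, t, rfl⟩ := Submodule.mem_span_pair.1 hrP
    obtain ⟨s', t', h⟩ := Submodule.mem_span_pair.1 hxr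
    obtain ⟨h1, h2, h3, h4⟩ := hind (s' - 1) (t' - 1) (s' - s) (t' - t) (by
      rw [← sub_eq_zero] at h
      rw [← h]
      module)
    rw [show s = 1 by linear_combination h1 - h3, show t = 1 by linear_combination h2 - h4,
      one_smul, one_smul]
  have hlin : LinearIndependent k ![x, y, z, w] := by
    rw [Fintype.linearIndependent_iff]
    intro g hg
    simp only [Fin.sum_univ_four, Matrix.cons_val] at hg
    obtain ⟨h1, h2, h3, h4⟩ := hind _ _ _ _ hg
    intro i
    fin_cases i <;> assumption
  refine ⟨basisOfLinearIndependentOfCardEqFinrank hlin (by simp [hV]), ?_, ?_⟩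
  · ext1 i
    fin_cases i
    · simpa [skewPlanes] using hP0
    · simpa [skewPlanes] using hP1
    · simpa [skewPlanes] using hP2
  · ext1 i
    rw [hr'] at hQ2
    fin_cases i
    · simpa [skewPlanes] using hQ0
    · simpa [skewPlanes] using hQ1
    · simpa [skewPlanes] using hQ2

section Coordinates

variable (b : Module.Basis (Fin 4) k V)

theorem skewPlanes_zero_repr {v : V} (h : v ∈ skewPlanes (k := k) (b 0) (b 1) (b 2) (b 3) 0) :
    b.repr v 2 = 0 ∧ b.repr v 3 = 0 := by
  obtain ⟨s, t, rfl⟩ := Submodule.mem_span_pair.1 h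
  simp

theorem skewPlanes_one_repr {v : V} (h : v ∈ skewPlanes (k := k) (b 0) (b 1) (b 2) (b 3) 1) :
    b.repr v 0 = 0 ∧ b.repr v 1 = 0 := by
  obtain ⟨s, t, rfl⟩ := Submodule.mem_span_pair.1 h
  simp

theorem skewPlanes_two_repr {v : V} (h : v ∈ skewPlanes (k := k) (b 0) (b 1) (b 2) (b 3) 2) :
    b.repr v 0 = b.repr v 2 ∧ b.repr v 1 = b.repr v 3 := by
  obtain ⟨s, t, rfl⟩ := Submodule.mem_span_pair.1 h
  simp

theorem finrank_skewPlanes (i : Fin 3) :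
    Module.finrank k (skewPlanes (k := k) (b 0) (b 1) (b 2) (b 3) i) = 2 := by
  have key : ∀ {x y : V}, (∀ s t : k, s • x + t • y = 0 → s = 0 ∧ t = 0) →
      Module.finrank k (Submodule.span k {x, y}) = 2 := fun h =>
    finrank_span_pair_of_linearIndependent (LinearIndependent.pair_iff.2 h)
  fin_cases i <;> refine key fun s t h => ?_
  · have h1 := congrArg (fun v => b.repr v 0) h
    have h2 := congrArg (fun v => b.repr v 1) h
    simp at h1 h2
    exact ⟨h1, h2⟩
  · have h1 := congrArg (fun v => b.repr v 2) h
    have h2 := congrArg (fun v => b.repr v 3) h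
    simp at h1 h2
    exact ⟨h1, h2⟩
  · have h1 := congrArg (fun v => b.repr v 0) h
    have h2 := congrArg (fun v => b.repr v 1) h
    simp at h1 h2
    exact ⟨h1, h2⟩

theorem disjoint_skewPlanes (i j : Fin 3) (hij : i ≠ j) :
    Disjoint (skewPlanes (k := k) (b 0) (b 1) (b 2) (b 3) i)
      (skewPlanes (b 0) (b 1) (b 2) (b 3) j) := by
  have key : ∀ v, b.repr v 0 = 0 → b.repr v 1 = 0 → b.repr v 2 = 0 → b.repr v 3 = 0 → v = 0 := by
    intro v h0 h1 h2 h3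
    refine b.ext_elem fun i => ?_
    fin_cases i <;> simpa
  wlog h : i < j generalizing i j
  · exact (this j i hij.symm (lt_of_le_of_ne (not_lt.1 h) hij.symm)).symm
  have hcases : (i = 0 ∧ j = 1) ∨ (i = 0 ∧ j = 2) ∨ (i = 1 ∧ j = 2) := by decide +revert
  rw [Submodule.disjoint_def]
  intro v hi hj
  rcases hcases with ⟨rfl, rfl⟩ | ⟨rfl, rfl⟩ | ⟨rfl, rfl⟩
  · obtain ⟨h2, h3⟩ := skewPlanes_zero_repr b hi
    obtain ⟨h0, h1⟩ := skewPlanes_one_repr b hj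
    exact key v h0 h1 h2 h3
  · obtain ⟨h2, h3⟩ := skewPlanes_zero_repr b hi
    obtain ⟨h0, h1⟩ := skewPlanes_two_repr b hj
    exact key v (h0.trans h2) (h1.trans h3) h2 h3
  · obtain ⟨h2, h3⟩ := skewPlanes_one_repr b hi
    obtain ⟨h0, h1⟩ := skewPlanes_two_repr b hj
    exact key v h2 h3 (h0.symm.trans h2) (h1.symm.trans h3)

/-- A linear map that preserves all lines of a grid is a homothety. -/
theorem exists_smul_of_map_skewPlanes_le (T : V →ₗ[k] V)
    (hP : ∀ i, (skewPlanes (b 0) (b 1) (b 2) (b 3) i).map T ≤ skewPlanes (b 0) (b 1) (b 2) (b 3) i)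
    (hQ : ∀ i, (skewPlanes (b 0) (b 2) (b 1) (b 3) i).map T ≤
      skewPlanes (b 0) (b 2) (b 1) (b 3) i) : ∃ c : k, ∀ v, T v = c • v := by
  -- Swapping the two middle basis vectors exchanges the two families of lines.
  let e : Fin 4 ≃ Fin 4 := Equiv.swap 1 2
  let b' := b.reindex e
  have hb' : b' 0 = b 0 ∧ b' 1 = b 2 ∧ b' 2 = b 1 ∧ b' 3 = b 3 := by
    refine ⟨?_, ?_, ?_, ?_⟩ <;> rw [Module.Basis.reindex_apply] <;> rfl
  have hr' : ∀ v, b'.repr v 0 = b.repr v 0 ∧ b'.repr v 1 = b.repr v 2 ∧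
      b'.repr v 2 = b.repr v 1 ∧ b'.repr v 3 = b.repr v 3 := by
    intro v
    refine ⟨?_, ?_, ?_, ?_⟩ <;> rw [Module.Basis.repr_reindex_apply] <;> rfl
  obtain ⟨hb0, hb1, hb2, hb3⟩ := hb'
  have hP' : ∀ i v, v ∈ skewPlanes (k := k) (b 0) (b 1) (b 2) (b 3) i →
      T v ∈ skewPlanes (k := k) (b 0) (b 1) (b 2) (b 3) i := fun i v hv =>
    hP i (Submodule.mem_map_of_mem hv)
  have hQ' : ∀ i v, v ∈ skewPlanes (k := k) (b 0) (b 2) (b 1) (b 3) i →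
      T v ∈ skewPlanes (k := k) (b' 0) (b' 1) (b' 2) (b' 3) i := by
    rw [hb0, hb1, hb2, hb3]
    exact fun i v hv => hQ i (Submodule.mem_map_of_mem hv)
  have mem₁ : ∀ u v : V, u ∈ Submodule.span k {u, v} := fun u v => Submodule.subset_span (by simp)
  have mem₂ : ∀ u v : V, v ∈ Submodule.span k {u, v} := fun u v => Submodule.subset_span (by simp)
  have a0 := skewPlanes_zero_repr b (hP' 0 (b 0) (mem₁ _ _))
  have a1 := skewPlanes_zero_repr b (hP' 0 (b 1) (mem₂ _ _))
  have a2 := skewPlanes_one_repr b (hP' 1 (b 2) (mem₁ _ _))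
  have a3 := skewPlanes_one_repr b (hP' 1 (b 3) (mem₂ _ _))
  have a4 := skewPlanes_two_repr b (hP' 2 (b 0 + b 2) (mem₁ _ _))
  have a5 := skewPlanes_two_repr b (hP' 2 (b 1 + b 3) (mem₂ _ _))
  have c0 := skewPlanes_zero_repr b' (hQ' 0 (b 0) (mem₁ _ _))
  have c1 := skewPlanes_zero_repr b' (hQ' 0 (b 2) (mem₂ _ _))
  have c2 := skewPlanes_one_repr b' (hQ' 1 (b 1) (mem₁ _ _))
  have c3 := skewPlanes_one_repr b' (hQ' 1 (b 3) (mem₂ _ _))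
  have c4 := skewPlanes_two_repr b' (hQ' 2 (b 0 + b 1) (mem₁ _ _))
  simp only [(hr' _).1, (hr' _).2.1, (hr' _).2.2.1, (hr' _).2.2.2] at c0 c1 c2 c3 c4
  simp only [map_add, Finsupp.add_apply] at a4 a5 c4
  have h1 : b.repr (T (b 1)) 1 = b.repr (T (b 0)) 0 := by
    have := c4.1
    rw [c2.1, c0.1] at this
    simpa using this.symm
  have h2 : b.repr (T (b 2)) 2 = b.repr (T (b 0)) 0 := by
    have := a4.1
    rw [a2.1, a0.1] at this
    simpa using this.symm
  have h3 : b.repr (T (b 3)) 3 = b.repr (T (b 0)) 0 := by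
    have := a5.2
    rw [a3.2, a1.2, h1] at this
    simpa using this.symm
  refine ⟨b.repr (T (b 0)) 0, fun v => ?_⟩
  have : T = b.repr (T (b 0)) 0 • LinearMap.id := by
    refine b.ext fun i => b.ext_elem fun j => ?_
    fin_cases i <;> fin_cases j <;> simp [*]
  exact LinearMap.congr_fun this v

end Coordinates

end SkewPlanes

/-! ### Totally isotropic grids and similitudes -/

section Isotropic

variable {k : Type*} [Field k] {σ : k →+* k} {q : ℕ} {V : Type*} [AddCommGroup V] [Module k V]

/-- The subspace `W` is totally isotropic for the sesquilinear form `B`. -/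
def IsTotallyIsotropic (B : V →ₛₗ[σ] V →ₗ[k] k) (W : Submodule k V) : Prop :=
  ∀ u ∈ W, ∀ v ∈ W, B u v = 0

theorem isTotallyIsotropic_span_pair {B : V →ₛₗ[σ] V →ₗ[k] k} {x y : V} (hxx : B x x = 0)
    (hyy : B y y = 0) (hxy : B x y = 0) (hyx : B y x = 0) :
    IsTotallyIsotropic B (Submodule.span k {x, y}) := by
  intro u hu v hv
  obtain ⟨s, t, rfl⟩ := Submodule.mem_span_pair.1 hu
  obtain ⟨s', t', rfl⟩ := Submodule.mem_span_pair.1 hv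
  simp [hxx, hyy, hxy, hyx]

/-- The Gram matrix of a form for which all lines of a grid in normal form are isotropic. -/
theorem exists_gram_eq_of_isTotallyIsotropic (B : V →ₛₗ[σ] V →ₗ[k] k) (b : Fin 4 → V)
    (hP : ∀ i, IsTotallyIsotropic B (skewPlanes (b 0) (b 1) (b 2) (b 3) i))
    (hQ : ∀ i, IsTotallyIsotropic B (skewPlanes (b 0) (b 2) (b 1) (b 3) i)) :
    ∃ c, ∀ i j, B (b i) (b j) =
      c * !![0, 0, 0, 1; 0, 0, -1, 0; 0, -1, 0, 0; 1, 0, 0, 0] i j := by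
  have mem₁ : ∀ u v : V, u ∈ Submodule.span k {u, v} := fun u v => Submodule.subset_span (by simp)
  have mem₂ : ∀ u v : V, v ∈ Submodule.span k {u, v} := fun u v => Submodule.subset_span (by simp)
  have key : ∀ {x y : V}, IsTotallyIsotropic B (Submodule.span k {x, y}) →
      B x x = 0 ∧ B y y = 0 ∧ B x y = 0 ∧ B y x = 0 := fun {x y} h =>
    ⟨h x (mem₁ _ _) x (mem₁ _ _), h y (mem₂ _ _) y (mem₂ _ _), h x (mem₁ _ _) y (mem₂ _ _),
      h y (mem₂ _ _) x (mem₁ _ _)⟩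
  obtain ⟨h00, h11, h01, h10⟩ := key (hP 0)
  obtain ⟨h22, h33, h23, h32⟩ := key (hP 1)
  obtain ⟨-, -, hp, hp'⟩ := key (hP 2)
  obtain ⟨-, -, h02, h20⟩ := key (hQ 0)
  obtain ⟨-, -, h13, h31⟩ := key (hQ 1)
  obtain ⟨-, -, hq, -⟩ := key (hQ 2)
  simp only [map_add, LinearMap.add_apply, h01, h10, h23, h32, h02, h13, zero_add,
    add_zero] at hp hp' hq
  have h21 : B (b 2) (b 1) = - B (b 0) (b 3) := by linear_combination hp
  have h12 : B (b 1) (b 2) = - B (b 0) (b 3) := by linear_combination hq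
  have h30 : B (b 3) (b 0) = B (b 0) (b 3) := by linear_combination hp' - hq
  refine ⟨B (b 0) (b 3), fun i j => ?_⟩
  fin_cases i <;> fin_cases j <;> simp [*]

theorem map_equiv_skewPlanes (b b' : Module.Basis (Fin 4) k V) (i₀ i₁ i₂ i₃ : Fin 4) (i : Fin 3) :
    (skewPlanes (b i₀) (b i₁) (b i₂) (b i₃) i).map (b.equiv b' (Equiv.refl _)).toLinearMap =
      skewPlanes (b' i₀) (b' i₁) (b' i₂) (b' i₃) i := by
  fin_cases i <;> simp [skewPlanes, Submodule.map_span, Set.image_pair]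

theorem map_eq_smul_of_gram (B : V →ₛₗ[σ] V →ₗ[k] k) (b : Module.Basis (Fin 4) k V)
    (T : V →ₗ[k] V) (r : k) (h : ∀ i j, B (T (b i)) (T (b j)) = r * B (b i) (b j)) (u v : V) :
    B (T u) (T v) = r * B u v := by
  have h1 : ∀ i v, B (T (b i)) (T v) = r * B (b i) v := fun i v =>
    LinearMap.congr_fun (b.ext (h i) : (B (T (b i))).comp T = r • B (b i)) v
  exact LinearMap.congr_fun
    (b.ext (fun i => h1 i v) : (B.flip (T v)).comp T = r • B.flip v) u

/-- Any two grids of isotropic lines are exchanged by a similitude. -/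
theorem exists_similitude (B : V →ₛₗ[σ] V →ₗ[k] k) (hB : B ≠ 0) (b b' : Module.Basis (Fin 4) k V)
    (hP : ∀ i, IsTotallyIsotropic B (skewPlanes (b 0) (b 1) (b 2) (b 3) i))
    (hQ : ∀ i, IsTotallyIsotropic B (skewPlanes (b 0) (b 2) (b 1) (b 3) i))
    (hP' : ∀ i, IsTotallyIsotropic B (skewPlanes (b' 0) (b' 1) (b' 2) (b' 3) i))
    (hQ' : ∀ i, IsTotallyIsotropic B (skewPlanes (b' 0) (b' 2) (b' 1) (b' 3) i)) :
    ∃ r ≠ 0, ∀ v, B (b.equiv b' (Equiv.refl _) v) (b.equiv b' (Equiv.refl _) v) = r * B v v := by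
  obtain ⟨c, hc⟩ := exists_gram_eq_of_isTotallyIsotropic B b hP hQ
  obtain ⟨c', hc'⟩ := exists_gram_eq_of_isTotallyIsotropic B b' hP' hQ'
  have key : ∀ (b : Module.Basis (Fin 4) k V) (c : k), (∀ i j, B (b i) (b j) =
      c * !![0, 0, 0, 1; 0, 0, -1, 0; 0, -1, 0, 0; 1, 0, 0, 0] i j) → c ≠ 0 := by
    rintro b c h rfl
    exact hB (b.ext fun i => b.ext fun j => by simp [h])
  have hc0 := key b c hc
  refine ⟨c' / c, div_ne_zero (key b' c' hc') hc0, fun v => ?_⟩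
  refine map_eq_smul_of_gram B b (b.equiv b' (Equiv.refl _)).toLinearMap _ (fun i j => ?_) v v
  simp only [LinearEquiv.coe_coe, Module.Basis.equiv_apply, Equiv.refl_apply, hc, hc']
  field_simp

end Isotropic

/-! ### Existence of skew triples and their transversals -/

section Extension

variable {k : Type*} [Field k] [IsAlgClosed k] {σ : k →+* k} {q : ℕ}
  {V : Type*} [AddCommGroup V] [Module k V]

/-- Any three skew isotropic planes can be completed to a grid. -/
theorem exists_transversal_planes (hq : 2 ≤ q) (hσ : ∀ x, σ x = x ^ q)
    (B : V →ₛₗ[σ] V →ₗ[k] k) (hV : Module.finrank k V = 4) (hl : ∀ v, (∀ w, B v w = 0) → v = 0)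
    {P : Fin 3 → Submodule k V} (hP : ∀ i, Module.finrank k (P i) = 2)
    (hP' : ∀ i j, i ≠ j → Disjoint (P i) (P j)) (hB : ∀ i, IsTotallyIsotropic B (P i)) :
    ∃ Q : Fin 3 → Submodule k V, (∀ i, Module.finrank k (Q i) = 2) ∧
      (∀ i j, i ≠ j → Disjoint (Q i) (Q j)) ∧ (∀ i, IsTotallyIsotropic B (Q i)) ∧
      ∀ i j, P i ⊓ Q j ≠ ⊥ := by
  have : FiniteDimensional k V := Module.finite_of_finrank_pos (by omega)
  have h01 := hP' 0 1 (by decide)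
  have hcompl : IsCompl (P 0) (P 1) := by
    refine ⟨h01, codisjoint_iff.2 (Submodule.eq_top_of_finrank_eq ?_)⟩
    have := Submodule.finrank_sup_add_finrank_inf_eq (P 0) (P 1)
    rw [disjoint_iff.1 h01, finrank_bot, hP, hP] at this
    omega
  set p := (P 0).projection (P 1) hcompl with hp
  let s₀ : P 2 →ₗ[k] V := p.comp (P 2).subtype
  let s₁ : P 2 →ₗ[k] V := (P 2).subtype - s₀
  have hs₀ : ∀ w, s₀ w ∈ P 0 := fun w => Submodule.projection_apply_mem hcompl _
  have hp₁ : ∀ v, v - p v ∈ P 1 := fun v => by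
    rw [← Submodule.projection_apply_eq_zero_iff hcompl, map_sub,
      Submodule.projection_apply_of_mem_left hcompl (Submodule.projection_apply_mem hcompl _),
      sub_self]
  have hs₁ : ∀ w, s₁ w ∈ P 1 := fun w => hp₁ w
  have hs : ∀ w, s₀ w + s₁ w = w := fun w => add_sub_cancel _ _
  have inj₀ : ∀ w, s₀ w = 0 → w = 0 := by
    intro w hw
    have h := hs w
    rw [hw, zero_add] at h
    exact Subtype.ext (Submodule.disjoint_def.1 (hP' 1 2 (by decide)) _ (h ▸ hs₁ w) w.2)
  have inj₁ : ∀ w, s₁ w = 0 → w = 0 := by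
    intro w hw
    have h := hs w
    rw [hw, add_zero] at h
    exact Subtype.ext (Submodule.disjoint_def.1 (hP' 0 2 (by decide)) _ (h ▸ hs₀ w) w.2)
  have surj₁ : ∀ v ∈ P 1, ∃ w, s₁ w = v := by
    have h : Function.Surjective (s₁.codRestrict (P 1) hs₁) := by
      rw [← LinearMap.injective_iff_surjective_of_finrank_eq_finrank (by rw [hP, hP]),
        injective_iff_map_eq_zero]
      exact fun w hw => inj₁ w (congrArg Subtype.val hw)
    intro v hv
    obtain ⟨w, hw⟩ := h ⟨v, hv⟩
    exact ⟨w, congrArg Subtype.val hw⟩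
  -- The form `B(s₀ w, s₁ w')` on `P 2` is nondegenerate, since `B(s₀ w, ·)` already vanishes on `P
  -- 0` and `s₁` maps onto `P 1`.
  obtain ⟨a, b, hab, haa, hbb, hs'⟩ := exists_isotropic_triple hq hσ ((B.comp s₀).compl₂ s₁) (hP 2)
    (by
      intro w hw
      refine inj₀ w (hl _ fun v => ?_)
      obtain ⟨w', hw'⟩ := surj₁ _ (hp₁ v)
      rw [← add_sub_cancel (p v) v, map_add,
        hB 0 _ (hs₀ w) _ (Submodule.projection_apply_mem hcompl _), zero_add, ← hw']
      exact hw w')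
  rw [LinearIndependent.pair_iff] at hab
  -- Coordinates of the three isotropic vectors `a`, `b`, `a + b`.
  let α : Fin 3 → k := ![1, 0, 1]
  let β : Fin 3 → k := ![0, 1, 1]
  let c : Fin 3 → P 2 := fun i => α i • a + β i • b
  have hc : ∀ i, B (s₀ (c i)) (s₁ (c i)) = 0 := by
    intro i
    fin_cases i
    · simpa [c, α, β] using haa
    · simpa [c, α, β] using hbb
    · simpa [c, α, β] using hs'
  have hαβ : ∀ i j, i ≠ j → α i * β j - β i * α j ≠ 0 := by
    intro i j hij
    fin_cases i <;> fin_cases j <;> simp [α, β] at hij ⊢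
  have hind : ∀ i j, i ≠ j → ∀ x y : k, x • c i = y • c j → x = 0 := by
    intro i j hij x y h
    obtain ⟨h1, h2⟩ := hab (x * α i - y * α j) (x * β i - y * β j) (by
      rw [← sub_eq_zero] at h
      rw [← h]
      simp only [c]
      module)
    refine (mul_eq_zero.1 ?_).resolve_right (hαβ i j hij)
    linear_combination β j * h1 - α j * h2
  have hc0 : ∀ i, c i ≠ 0 := by
    intro i h
    obtain ⟨j, hj⟩ := exists_ne i
    exact one_ne_zero (hind i j hj.symm 1 0 (by rw [h]; simp))
  have hc₀ : ∀ i, s₀ (c i) ≠ 0 := fun i h => hc0 i (inj₀ _ h)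
  have hc₁ : ∀ i, s₁ (c i) ≠ 0 := fun i h => hc0 i (inj₁ _ h)
  have mem₁ : ∀ i, s₀ (c i) ∈ Submodule.span k {s₀ (c i), s₁ (c i)} := fun i =>
    Submodule.subset_span (by simp)
  have mem₂ : ∀ i, s₁ (c i) ∈ Submodule.span k {s₀ (c i), s₁ (c i)} := fun i =>
    Submodule.subset_span (by simp)
  refine ⟨fun i => Submodule.span k {s₀ (c i), s₁ (c i)}, fun i => ?_, fun i j hij => ?_,
    fun i => ?_, fun i j => ?_⟩
  · exact finrank_span_pair_of_linearIndependent
      (linearIndependent_pair_of_disjoint h01 (hs₀ _) (hs₁ _) (hc₀ i) (hc₁ i))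
  · rw [Submodule.disjoint_def]
    intro v hv hv'
    obtain ⟨x, y, rfl⟩ := Submodule.mem_span_pair.1 hv
    obtain ⟨x', y', h⟩ := Submodule.mem_span_pair.1 hv'
    have h1 : s₀ (x • c i - x' • c j) = s₁ (y' • c j - y • c i) := by
      simp only [map_sub, map_smul]
      rw [sub_eq_sub_iff_add_eq_add, ← h]
      abel
    have h2 : s₀ (x • c i - x' • c j) = 0 :=
      Submodule.disjoint_def.1 h01 _ (hs₀ _) (h1 ▸ hs₁ _)
    have h3 := inj₀ _ h2
    have h4 := inj₁ _ (h1.symm.trans h2)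
    rw [hind i j hij x x' (sub_eq_zero.1 h3), hind i j hij y y' (sub_eq_zero.1 h4).symm]
    simp
  · refine isTotallyIsotropic_span_pair (hB 0 _ (hs₀ _) _ (hs₀ _)) (hB 1 _ (hs₁ _) _ (hs₁ _))
      (hc i) ?_
    -- Expanding `B(c, c) = 0` with `c = s₀ c + s₁ c` leaves only the remaining product `B(s₁ c, s₀
    -- c)`.
    have h := hB 2 _ (c i).2 _ (c i).2
    rw [← hs (c i)] at h
    simpa [hc i, hB 0 _ (hs₀ (c i)) _ (hs₀ (c i)), hB 1 _ (hs₁ (c i)) _ (hs₁ (c i))] using h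
  · rw [Submodule.ne_bot_iff]
    fin_cases i
    · exact ⟨s₀ (c j), ⟨hs₀ _, mem₁ j⟩, hc₀ j⟩
    · exact ⟨s₁ (c j), ⟨hs₁ _, mem₂ j⟩, hc₁ j⟩
    · refine ⟨c j, ⟨(c j).2, ?_⟩, fun h => hc0 j (Subtype.ext h)⟩
      have := add_mem (mem₁ j) (mem₂ j)
      rwa [hs] at this

/-- The first equation gives `t = (s ^ q α)⁻¹`; the second then becomes `s ^ (q² - 1) = β / α ^ q`.
-/
theorem exists_scaling (hq : 2 ≤ q) {α β : k} (hα : α ≠ 0) (hβ : β ≠ 0) :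
    ∃ s t : k, s ≠ 0 ∧ t ≠ 0 ∧ s ^ q * t * α = 1 ∧ t ^ q * s * β = 1 := by
  have hqq : 1 < q * q := by nlinarith
  obtain ⟨s, hs⟩ := IsAlgClosed.exists_pow_nat_eq (β / α ^ q) (show 0 < q * q - 1 by omega)
  have hs0 : s ≠ 0 := by
    rintro rfl
    rw [zero_pow (by omega), eq_comm, div_eq_zero_iff] at hs
    exact hs.elim hβ (pow_ne_zero q hα)
  have h1 : s ^ (q * q) = s * (β / α ^ q) := by
    rw [← hs, ← pow_succ']
    congr 1
    omega
  refine ⟨s, (s ^ q * α)⁻¹, hs0, inv_ne_zero (mul_ne_zero (pow_ne_zero q hs0) hα), ?_, ?_⟩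
  · field_simp
  · rw [inv_pow, mul_pow, ← pow_mul, h1]
    field_simp

/-- A nondegenerate Frobenius-sesquilinear form in four variables has three skew
totally isotropic planes. -/
theorem exists_skew_isotropic_planes (hq : 2 ≤ q) (hσ : ∀ x, σ x = x ^ q)
    (B : V →ₛₗ[σ] V →ₗ[k] k) (hV : Module.finrank k V = 4)
    (hl : ∀ v, (∀ w, B v w = 0) → v = 0) (hr : ∀ w, (∀ v, B v w = 0) → w = 0) :
    ∃ P : Fin 3 → Submodule k V, (∀ i, Module.finrank k (P i) = 2) ∧
      (∀ i j, i ≠ j → Disjoint (P i) (P j)) ∧ ∀ i, IsTotallyIsotropic B (P i) := by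
  obtain ⟨a, b, c, d, hlin, haa, hbb, hcc, hdd, hab, hcd, hx⟩ :=
    exists_hyperbolic_splitting hq hσ B hV hl hr
  obtain ⟨hac, hca⟩ := hx a (by simp) c (by simp)
  obtain ⟨had, hda⟩ := hx a (by simp) d (by simp)
  obtain ⟨hbc, hcb⟩ := hx b (by simp) c (by simp)
  obtain ⟨hbd, hdb⟩ := hx b (by simp) d (by simp)
  have hba : B b a = - B a b := by
    simp only [map_add, LinearMap.add_apply, haa, hbb] at hab
    linear_combination hab
  have hdc : B d c = - B c d := by
    simp only [map_add, LinearMap.add_apply, hcc, hdd] at hcd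
    linear_combination hcd
  let e := basisOfLinearIndependentOfCardEqFinrank hlin (by simp [hV])
  have he : ⇑e = ![a, b, c, d] := coe_basisOfLinearIndependentOfCardEqFinrank _ _
  have hzero : ∀ v, B v a = 0 → B v b = 0 → B v c = 0 → B v d = 0 → v = 0 := by
    intro v h1 h2 h3 h4
    refine hl v fun w => LinearMap.congr_fun (e.ext fun i => ?_ : B v = 0) w
    rw [he]
    fin_cases i <;> simpa
  have hab0 : B a b ≠ 0 := fun h => hlin.ne_zero 0 (hzero a haa h hac had)
  have hcd0 : B c d ≠ 0 := fun h => hlin.ne_zero 2 (hzero c hca hcb hcc h)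
  -- The signs are chosen so that the hyperbolic pairs take the values `1, 1` and `-1, -1`; these
  -- cancel on the third plane.
  obtain ⟨s, t, hs0, ht0, hs, ht⟩ := exists_scaling hq hab0 (neg_ne_zero.2 hab0)
  obtain ⟨s', t', hs0', ht0', hs', ht'⟩ := exists_scaling hq (neg_ne_zero.2 hcd0) hcd0
  have hlin' : LinearIndependent k ![s • a, s' • c, t' • d, t • b] := by
    rw [Fintype.linearIndependent_iff] at hlin ⊢
    intro g hg
    have h := hlin ![g 0 * s, g 3 * t, g 1 * s', g 2 * t'] (by
      simp only [Fin.sum_univ_four, Matrix.cons_val] at hg ⊢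
      rw [← hg]
      module)
    have h0 := h 0
    have h1 := h 1
    have h2 := h 2
    have h3 := h 3
    simp [hs0, ht0, hs0', ht0'] at h0 h1 h2 h3
    intro i
    fin_cases i <;> assumption
  let f := basisOfLinearIndependentOfCardEqFinrank hlin' (by simp [hV])
  have hf : ⇑f = ![s • a, s' • c, t' • d, t • b] :=
    coe_basisOfLinearIndependentOfCardEqFinrank _ _
  have hf0 : f 0 = s • a := by rw [hf]; rfl
  have hf1 : f 1 = s' • c := by rw [hf]; rfl
  have hf2 : f 2 = t' • d := by rw [hf]; rfl
  have hf3 : f 3 = t • b := by rw [hf]; rfl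
  refine ⟨skewPlanes (f 0) (f 1) (f 2) (f 3), finrank_skewPlanes f, disjoint_skewPlanes f,
    fun i => ?_⟩
  rw [hf0, hf1, hf2, hf3]
  fin_cases i <;> refine isTotallyIsotropic_span_pair ?_ ?_ ?_ ?_ <;>
    simp only [map_add, map_smulₛₗ, LinearMap.add_apply, LinearMap.smul_apply, hσ, smul_eq_mul,
      RingHom.id_apply, haa, hbb, hcc, hdd, hac, hca, had, hda, hbc, hcb, hbd, hdb, hba, hdc,
      mul_zero, add_zero, zero_add]
  · linear_combination hs - ht'
  · linear_combination ht - hs'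

end Extension

/-! ### From Frobenius forms to sesquilinear forms -/

section FrobeniusForm

variable {k : Type*} [Field k] {n q : ℕ} {F : MvPolynomial (Fin n) k}

-- Taking the part of degree `q + 1` lets the cofactors of the `X i ^ q` be replaced by their linear
-- parts.
open MvPolynomial in
theorem homogeneousComponent_mul_X_pow {ι R : Type*} [CommSemiring R] (c : MvPolynomial ι R)
    (i : ι) (m q : ℕ) :
    homogeneousComponent (m + q) (c * X i ^ q) = homogeneousComponent m c * X i ^ q := by
  classical
  ext d
  rw [X_pow_eq_monomial, coeff_homogeneousComponent, coeff_mul_monomial', coeff_mul_monomial',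
    coeff_homogeneousComponent]
  by_cases h : Finsupp.single i q ≤ d
  · have hd : d.degree = (d - Finsupp.single i q).degree + q := by
      conv_lhs => rw [← tsub_add_cancel_of_le h, map_add, Finsupp.degree_single]
    simp only [if_pos h, hd, add_left_inj, ite_mul, zero_mul]
  · simp only [h, if_false, ite_self]

open MvPolynomial in
/-- The matrix of a Frobenius form. -/
theorem IsFrobeniusForm.exists_matrix (hF : IsFrobeniusForm q F) :
    ∃ A : Matrix (Fin n) (Fin n) k, F = ∑ i, ∑ j, C (A i j) * X j * X i ^ q := by
  obtain ⟨hh, hmem⟩ := hF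
  obtain ⟨c, hc⟩ := Ideal.mem_span_range_iff_exists_fun.1 hmem
  have hlin : ∀ i, ∃ a : Fin n → k, ∑ j, a j • (X j : MvPolynomial (Fin n) k) =
      homogeneousComponent 1 (c i) := fun i => by
    rw [← Submodule.mem_span_range_iff_exists_fun, ← homogeneousSubmodule_one_eq_span_X]
    exact homogeneousComponent_mem _ _
  choose A hA using hlin
  refine ⟨A, ?_⟩
  rw [← homogeneousComponent_eq_self hh, ← hc, map_sum]
  refine Finset.sum_congr rfl fun i _ => ?_
  rw [add_comm, homogeneousComponent_mul_X_pow, ← hA, Finset.sum_mul]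
  simp only [smul_eq_C_mul]

variable {σ : k →+* k}

/-- A smooth Frobenius form is given by a nondegenerate Frobenius-sesquilinear form. -/
theorem IsFrobeniusForm.exists_sesquilinear [IsAlgClosed k] (hq : 2 ≤ q) (hσ : ∀ x, σ x = x ^ q)
    (hq0 : (q : k) = 0) (hF : IsFrobeniusForm q F) (hs : IsSmoothForm F) :
    ∃ B : (Fin n → k) →ₛₗ[σ] (Fin n → k) →ₗ[k] k, (∀ v, MvPolynomial.eval v F = B v v) ∧
      (∀ v, (∀ w, B v w = 0) → v = 0) ∧ (∀ w, (∀ v, B v w = 0) → w = 0) := by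
  obtain ⟨A, hA⟩ := hF.exists_matrix
  let B := Matrix.toLinearMapₛₗ₂' k σ (RingHom.id k) A
  have hB : ∀ v w, B v w = ∑ i, ∑ j, A i j * w j * v i ^ q := by
    intro v w
    simp only [B, Matrix.toLinearMapₛₗ₂'_apply, hσ, smul_eq_mul, RingHom.id_apply]
    exact Finset.sum_congr rfl fun i _ => Finset.sum_congr rfl fun j _ => by ring
  have hev : ∀ v, MvPolynomial.eval v F = B v v := fun v => by rw [hB, hA]; simp
  have hd : ∀ v j, MvPolynomial.eval v (MvPolynomial.pderiv j F) = B v (Pi.single j 1) := by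
    intro v j
    rw [hB, hA]
    have hcast : (q : MvPolynomial (Fin n) k) = 0 := by
      rw [← map_natCast MvPolynomial.C, hq0, map_zero]
    have hX : ∀ i, MvPolynomial.pderiv j (MvPolynomial.X i ^ q : MvPolynomial (Fin n) k) = 0 :=
      fun i => by rw [MvPolynomial.pderiv_pow, hcast, zero_mul, zero_mul]
    have h1 : ∀ i l, MvPolynomial.pderiv j
        (MvPolynomial.C (A i l) * MvPolynomial.X l * MvPolynomial.X i ^ q) =
        MvPolynomial.C (A i l * (Pi.single j 1 : Fin n → k) l) * MvPolynomial.X i ^ q := by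
      intro i l
      rw [MvPolynomial.pderiv_mul, hX, MvPolynomial.pderiv_C_mul, MvPolynomial.pderiv_X,
        mul_zero, add_zero]
      by_cases h : l = j
      · subst h; simp
      · simp [h]
    simp [h1]
  have hl : ∀ v, (∀ w, B v w = 0) → v = 0 := by
    intro v hv
    by_contra hv0
    obtain ⟨j, hj⟩ := hs v hv0 (by rw [hev, hv])
    exact hj (by rw [hd, hv])
  refine ⟨B, hev, hl, fun w hw => ?_⟩
  by_contra hw0
  have hdet : A.det = 0 := Matrix.exists_mulVec_eq_zero_iff.1 ⟨w, hw0, by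
    ext i
    have := hw (Pi.single i 1)
    rw [hB] at this
    simpa [Matrix.mulVec, dotProduct, Pi.single_apply, ite_pow, show q ≠ 0 by omega] using this⟩
  -- The `q`-th roots of the entries of a left kernel vector of `A` form a vector in the left
  -- radical of `B`, which is zero.
  obtain ⟨u, hu0, hu⟩ := Matrix.exists_vecMul_eq_zero_iff.2 hdet
  choose v hv using fun i => IsAlgClosed.exists_pow_nat_eq (u i) (show 0 < q by omega)
  refine hu0 ?_
  have hv0 : v = 0 := hl v fun w => by
    rw [hB, Finset.sum_comm]
    refine Finset.sum_eq_zero fun j _ => ?_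
    have h := congrFun hu j
    simp only [Matrix.vecMul, dotProduct, Pi.zero_apply] at h
    calc ∑ i, A i j * w j * v i ^ q = (∑ i, u i * A i j) * w j := by
          rw [Finset.sum_mul]
          exact Finset.sum_congr rfl fun i _ => by rw [hv]; ring
      _ = 0 := by rw [h, zero_mul]
  ext i
  rw [← hv i, hv0]
  simp [show q ≠ 0 by omega]

/-- Evaluating on `u + v` and `u + t v` gives `(t - t ^ q) B(u, v) = 0`, and some `t` in an infinite
field satisfies `t ≠ t ^ q`. -/
theorem isTotallyIsotropic_of_apply_self_eq_zero [Infinite k] {V : Type*} [AddCommGroup V]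
    [Module k V] (hq : 2 ≤ q) (hσ : ∀ x, σ x = x ^ q) {B : V →ₛₗ[σ] V →ₗ[k] k} {W : Submodule k V}
    (h : ∀ w ∈ W, B w w = 0) : IsTotallyIsotropic B W := by
  intro u hu v hv
  obtain ⟨t, ht⟩ : ∃ t : k, t - t ^ q ≠ 0 := by
    have hP : (Polynomial.X - Polynomial.X ^ q : Polynomial k) ≠ 0 := by
      intro h0
      have := congrArg (fun P : Polynomial k => P.coeff 1) h0
      simp [Polynomial.coeff_X_pow, show 1 ≠ q by omega] at this
    by_contra! h
    exact hP (Polynomial.funext fun t => by simpa using h t)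
  have h1 := h _ (add_mem hu hv)
  have h2 := h _ (add_mem hu (W.smul_mem t hv))
  simp only [map_add, map_smulₛₗ, LinearMap.add_apply, LinearMap.smul_apply, hσ, smul_eq_mul,
    RingHom.id_apply, h u hu, h v hv] at h1 h2
  refine (mul_eq_zero.1 (?_ : (t - t ^ q) * _ = 0)).resolve_left ht
  linear_combination h2 - t ^ q * h1

end FrobeniusForm

/-! ### Lines on the surface and the action of `PGL(4, k)` -/

section Lines

variable {k : Type*} [Field k]

/-- The set of points of the projectivization of a subspace of `k⁴`. -/
def projPoints (W : Submodule k (Fin 4 → k)) : Set (ℙ k (Fin 4 → k)) :=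
  {P | P.submodule ≤ W}

theorem mk_mem_projPoints {W : Submodule k (Fin 4 → k)} {v : Fin 4 → k} (hv : v ≠ 0) :
    Projectivization.mk k v hv ∈ projPoints W ↔ v ∈ W := by
  rw [projPoints, Set.mem_ofPred_eq, Projectivization.submodule_mk,
    Submodule.span_singleton_le_iff_mem]

theorem projPoints_injective : Function.Injective (projPoints (k := k)) := by
  intro W W' h
  ext v
  by_cases hv : v = 0
  · simp [hv]
  · rw [← mk_mem_projPoints hv, h, mk_mem_projPoints hv]

theorem projPoints_inter_nonempty {W W' : Submodule k (Fin 4 → k)} :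
    (projPoints W ∩ projPoints W').Nonempty ↔ W ⊓ W' ≠ ⊥ := by
  rw [Submodule.ne_bot_iff]
  constructor
  · rintro ⟨P, h1, h2⟩
    induction P using Projectivization.ind with | _ v hv =>
    exact ⟨v, ⟨(mk_mem_projPoints hv).1 h1, (mk_mem_projPoints hv).1 h2⟩, hv⟩
  · rintro ⟨v, ⟨h1, h2⟩, hv⟩
    exact ⟨_, (mk_mem_projPoints hv).2 h1, (mk_mem_projPoints hv).2 h2⟩

theorem disjoint_projPoints {W W' : Submodule k (Fin 4 → k)} :
    Disjoint (projPoints W) (projPoints W') ↔ Disjoint W W' := by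
  rw [Set.disjoint_iff_inter_eq_empty, ← Set.not_nonempty_iff_eq_empty, projPoints_inter_nonempty,
    not_not, disjoint_iff]

theorem mk_mem_projZeroLocus {n : ℕ} {σ : k →+* k} {F : MvPolynomial (Fin n) k}
    {B : (Fin n → k) →ₛₗ[σ] (Fin n → k) →ₗ[k] k} (hB : ∀ v, MvPolynomial.eval v F = B v v)
    {v : Fin n → k} (hv : v ≠ 0) :
    Projectivization.mk k v hv ∈ projZeroLocus F ↔ B v v = 0 := by
  rw [projZeroLocus, Set.mem_ofPred_eq, Projectivization.submodule_mk]
  refine ⟨fun h => (hB v).symm.trans (h v (Submodule.mem_span_singleton_self v)), fun h w hw => ?_⟩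
  obtain ⟨c, rfl⟩ := Submodule.mem_span_singleton.1 hw
  simp [hB, h]

theorem mk_smul_projPoints (g : GL (Fin 4) k) {W W' : Submodule k (Fin 4 → k)} :
    (Matrix.ProjGenLinGroup.mk g : PGL(4, k)) • projPoints W = projPoints W' ↔
      W.map (Matrix.mulVecLin g.1) = W' := by
  have : (Matrix.ProjGenLinGroup.mk g : PGL(4, k)) • projPoints W =
      projPoints (W.map (Matrix.mulVecLin g.1)) := by
    ext P
    induction P using Projectivization.ind with | _ v hv =>
    rw [Set.mem_smul_set_iff_inv_smul_mem, ← map_inv, Projectivization.PGL.mk_smul_mk,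
      mk_mem_projPoints, mk_mem_projPoints]
    constructor
    · intro h
      exact ⟨g⁻¹ • v, h, smul_inv_smul g v⟩
    · rintro ⟨w, hw, rfl⟩
      rw [show Matrix.mulVecLin g.1 w = g • w from rfl, inv_smul_smul]
      exact hw
  rw [this, projPoints_injective.eq_iff]

theorem exists_generalLinearGroup_mulVecLin_eq (T : (Fin 4 → k) ≃ₗ[k] (Fin 4 → k)) :
    ∃ g : GL (Fin 4) k, Matrix.mulVecLin g.1 = T.toLinearMap :=
  ⟨⟨LinearMap.toMatrix' T.toLinearMap, LinearMap.toMatrix' T.symm.toLinearMap,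
    by rw [← LinearMap.toMatrix'_comp]; simp, by rw [← LinearMap.toMatrix'_comp]; simp⟩,
    by rw [← Matrix.toLin'_apply', Matrix.toLin'_toMatrix']⟩

/-- A similitude of the form induces an automorphism of the surface. -/
theorem mk_mem_projAut {σ : k →+* k} {F : MvPolynomial (Fin 4) k}
    {B : (Fin 4 → k) →ₛₗ[σ] (Fin 4 → k) →ₗ[k] k} (hB : ∀ v, MvPolynomial.eval v F = B v v)
    {g : GL (Fin 4) k} {r : k} (hr : r ≠ 0)
    (hg : ∀ v, B (Matrix.mulVecLin g.1 v) (Matrix.mulVecLin g.1 v) = r * B v v) :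
    (Matrix.ProjGenLinGroup.mk g : PGL(4, k)) ∈ projAut (projZeroLocus F) := by
  rw [projAut, MulAction.mem_stabilizer_iff]
  ext P
  induction P using Projectivization.ind with | _ v hv =>
  rw [Set.mem_smul_set_iff_inv_smul_mem, ← map_inv, Projectivization.PGL.mk_smul_mk,
    mk_mem_projZeroLocus hB, mk_mem_projZeroLocus hB]
  have h := hg (g⁻¹ • v)
  rw [show Matrix.mulVecLin g.1 (g⁻¹ • v) = v from smul_inv_smul g v] at h
  rw [h, mul_eq_zero, or_iff_right hr]

theorem IsSkewTriple.exists_planes [Infinite k] {q : ℕ} {σ : k →+* k} {F : MvPolynomial (Fin 4) k}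
    {B : (Fin 4 → k) →ₛₗ[σ] (Fin 4 → k) →ₗ[k] k} (hq : 2 ≤ q) (hσ : ∀ x, σ x = x ^ q)
    (hB : ∀ v, MvPolynomial.eval v F = B v v) {L : Fin 3 → Set (ℙ k (Fin 4 → k))}
    (hL : IsSkewTriple (projZeroLocus F) L) :
    ∃ P : Fin 3 → Submodule k (Fin 4 → k), (∀ i, L i = projPoints (P i)) ∧
      (∀ i, Module.finrank k (P i) = 2) ∧ (∀ i j, i ≠ j → Disjoint (P i) (P j)) ∧
      ∀ i, IsTotallyIsotropic B (P i) := by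
  choose P hP hLP using hL.isLine
  refine ⟨P, hLP, hP, fun i j hij => ?_, fun i => ?_⟩
  · rw [← disjoint_projPoints]
    have := hL.skew i j hij
    rwa [hLP, hLP] at this
  · refine isTotallyIsotropic_of_apply_self_eq_zero hq hσ fun w hw => ?_
    by_cases hw0 : w = 0
    · simp [hw0]
    · rw [← mk_mem_projZeroLocus hB hw0]
      refine hL.subset i ?_
      rw [hLP]
      exact (mk_mem_projPoints hw0).2 hw

theorem isSkewTriple_projPoints {σ : k →+* k} {F : MvPolynomial (Fin 4) k}
    {B : (Fin 4 → k) →ₛₗ[σ] (Fin 4 → k) →ₗ[k] k}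
    (hB : ∀ v, MvPolynomial.eval v F = B v v) {P : Fin 3 → Submodule k (Fin 4 → k)}
    (hP : ∀ i, Module.finrank k (P i) = 2) (hP' : ∀ i j, i ≠ j → Disjoint (P i) (P j))
    (hPB : ∀ i, IsTotallyIsotropic B (P i)) :
    IsSkewTriple (projZeroLocus F) fun i => projPoints (P i) where
  isLine i := ⟨P i, hP i, rfl⟩
  subset i Q hQ := by
    induction Q using Projectivization.ind with | _ v hv =>
    rw [mk_mem_projPoints] at hQ
    rw [mk_mem_projZeroLocus hB]
    exact hPB i v hQ v hQ
  skew i j hij := disjoint_projPoints.2 (hP' i j hij)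

/-- The planes of a sextuple have a normal form. -/
theorem IsSkewSextuple.exists_basis [Infinite k] {q : ℕ} {σ : k →+* k}
    {F : MvPolynomial (Fin 4) k}
    {B : (Fin 4 → k) →ₛₗ[σ] (Fin 4 → k) →ₗ[k] k} (hq : 2 ≤ q) (hσ : ∀ x, σ x = x ^ q)
    (hB : ∀ v, MvPolynomial.eval v F = B v v) {L M : Fin 3 → Set (ℙ k (Fin 4 → k))}
    (h : IsSkewSextuple (projZeroLocus F) L M) :
    ∃ b : Module.Basis (Fin 4) k (Fin 4 → k),
      (∀ i, L i = projPoints (skewPlanes (b 0) (b 1) (b 2) (b 3) i)) ∧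
      (∀ i, M i = projPoints (skewPlanes (b 0) (b 2) (b 1) (b 3) i)) ∧
      (∀ i, IsTotallyIsotropic B (skewPlanes (b 0) (b 1) (b 2) (b 3) i)) ∧
      ∀ i, IsTotallyIsotropic B (skewPlanes (b 0) (b 2) (b 1) (b 3) i) := by
  obtain ⟨P, hLP, hP, hP', hPB⟩ := h.left.exists_planes hq hσ hB
  obtain ⟨Q, hMQ, hQ, hQ', hQB⟩ := h.right.exists_planes hq hσ hB
  obtain ⟨b, rfl, rfl⟩ := exists_basis_skewPlanes (by simp) hP hP' hQ hQ' fun i j => by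
    rw [← projPoints_inter_nonempty, ← hLP, ← hMQ]
    exact h.meet i j
  exact ⟨b, hLP, hMQ, hPB, hQB⟩

theorem IsSkewTriple.exists_sextuple [IsAlgClosed k] {q : ℕ} {σ : k →+* k}
    {F : MvPolynomial (Fin 4) k}
    {B : (Fin 4 → k) →ₛₗ[σ] (Fin 4 → k) →ₗ[k] k} (hq : 2 ≤ q) (hσ : ∀ x, σ x = x ^ q)
    (hB : ∀ v, MvPolynomial.eval v F = B v v) (hl : ∀ v, (∀ w, B v w = 0) → v = 0)
    {L : Fin 3 → Set (ℙ k (Fin 4 → k))} (hL : IsSkewTriple (projZeroLocus F) L) :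
    ∃ M, IsSkewSextuple (projZeroLocus F) L M := by
  have : Infinite k := IsAlgClosed.instInfinite
  obtain ⟨P, hLP, hP, hP', hPB⟩ := hL.exists_planes hq hσ hB
  obtain ⟨Q, hQ, hQ', hQB, hPQ⟩ := exists_transversal_planes hq hσ B (by simp) hl hP hP' hPB
  exact ⟨fun i => projPoints (Q i), hL, isSkewTriple_projPoints hB hQ hQ' hQB, fun i j => by
    rw [hLP, projPoints_inter_nonempty]
    exact hPQ i j⟩

theorem IsSkewSextuple.existsUnique_smul_eq [IsAlgClosed k] {q : ℕ} {σ : k →+* k}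
    {F : MvPolynomial (Fin 4) k}
    {B : (Fin 4 → k) →ₛₗ[σ] (Fin 4 → k) →ₗ[k] k} (hq : 2 ≤ q) (hσ : ∀ x, σ x = x ^ q)
    (hB : ∀ v, MvPolynomial.eval v F = B v v) (hB0 : B ≠ 0)
    {L M L' M' : Fin 3 → Set (ℙ k (Fin 4 → k))} (h : IsSkewSextuple (projZeroLocus F) L M)
    (h' : IsSkewSextuple (projZeroLocus F) L' M') :
    ∃! g : PGL(4, k), g ∈ projAut (projZeroLocus F) ∧ (∀ i, g • L i = L' i) ∧
      ∀ i, g • M i = M' i := by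
  have : Infinite k := IsAlgClosed.instInfinite
  obtain ⟨b, hL, hM, hPB, hQB⟩ := h.exists_basis hq hσ hB
  obtain ⟨b', hL', hM', hPB', hQB'⟩ := h'.exists_basis hq hσ hB
  obtain ⟨r, hr, hT⟩ := exists_similitude B hB0 b b' hPB hQB hPB' hQB'
  obtain ⟨g, hg⟩ := exists_generalLinearGroup_mulVecLin_eq (b.equiv b' (Equiv.refl _))
  have hgL : ∀ i, (Matrix.ProjGenLinGroup.mk g : PGL(4, k)) • L i = L' i := fun i => by
    rw [hL, hL', mk_smul_projPoints, hg, map_equiv_skewPlanes]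
  have hgM : ∀ i, (Matrix.ProjGenLinGroup.mk g : PGL(4, k)) • M i = M' i := fun i => by
    rw [hM, hM', mk_smul_projPoints, hg, map_equiv_skewPlanes]
  refine ⟨.mk g, ⟨mk_mem_projAut hB hr fun v => ?_, hgL, hgM⟩, ?_⟩
  · rw [hg]
    exact hT v
  · rintro f ⟨-, hfL, hfM⟩
    -- Two solutions differ by an element that preserves every line of the first grid, hence comes
    -- from a scalar matrix.
    rw [← inv_mul_eq_one]
    obtain ⟨a, ha⟩ := Matrix.ProjGenLinGroup.mk_surjective
      (f⁻¹ * Matrix.ProjGenLinGroup.mk g : PGL(4, k))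
    have haL : ∀ i, (Matrix.ProjGenLinGroup.mk a : PGL(4, k)) • L i = L i := fun i => by
      rw [ha, mul_smul, hgL, ← hfL, inv_smul_smul]
    have haM : ∀ i, (Matrix.ProjGenLinGroup.mk a : PGL(4, k)) • M i = M i := fun i => by
      rw [ha, mul_smul, hgM, ← hfM, inv_smul_smul]
    simp only [hL, hM, mk_smul_projPoints] at haL haM
    obtain ⟨c, hc⟩ := exists_smul_of_map_skewPlanes_le b (Matrix.mulVecLin a.1)
      (fun i => (haL i).le) (fun i => (haM i).le)
    have hc0 : c ≠ 0 := by
      rintro rfl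
      have h1 : a • b 0 = 0 := (hc (b 0)).trans (zero_smul _ _)
      exact (smul_ne_zero_iff_ne a).2 (b.ne_zero 0) h1
    rw [← ha, ← map_one Matrix.ProjGenLinGroup.mk, eq_comm, Matrix.ProjGenLinGroup.mk_eq_mk_iff]
    refine ⟨Units.mk0 c hc0, ?_⟩
    rw [one_mul]
    refine Units.ext (Matrix.ext_of_mulVec_single fun i => ?_)
    have := hc (Pi.single i 1)
    rw [Matrix.mulVecLin_apply] at this
    rw [this]
    ext j
    simp [Pi.single_apply]

end Lines

theorem mainTheorem5 {k : Type*} [Field k] [IsAlgClosed k] (p : ℕ) [Fact p.Prime] [CharP k p]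
    (e : ℕ) (he : 0 < e) (X : Set (ℙ k (Fin 4 → k))) (hX : IsSmoothExtremalSurface (p ^ e) X) :
    -- transitivity on ordered triples of skew lines
    (∀ L L' : Fin 3 → Set (ℙ k (Fin 4 → k)), IsSkewTriple X L → IsSkewTriple X L' →
      ∃ g ∈ projAut X, ∀ i, g • L i = L' i) ∧
    -- simple transitivity on the nonempty set of ordered sextuples
    (∃ L M : Fin 3 → Set (ℙ k (Fin 4 → k)), IsSkewSextuple X L M) ∧
    (∀ L M L' M' : Fin 3 → Set (ℙ k (Fin 4 → k)),
      IsSkewSextuple X L M → IsSkewSextuple X L' M' →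
      ∃! g : PGL(4, k), g ∈ projAut X ∧ (∀ i, g • L i = L' i) ∧ (∀ i, g • M i = M' i)) := by
  obtain ⟨F, hF, hs, rfl⟩ := hX
  have hp : p.Prime := Fact.out
  have : ExpChar k p := ExpChar.prime hp
  have hq : 2 ≤ p ^ e := hp.two_le.trans (Nat.le_self_pow he.ne' p)
  have hσ : ∀ x, iterateFrobenius k p e x = x ^ p ^ e := iterateFrobenius_def p e
  obtain ⟨B, hB, hl, hr⟩ := hF.exists_sesquilinear hq hσ
    (by rw [Nat.cast_pow, CharP.cast_eq_zero, zero_pow he.ne']) hs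
  have hB0 : B ≠ 0 := by
    rintro rfl
    exact one_ne_zero (congrFun (hl 1 fun w => rfl) 0)
  refine ⟨fun L L' hL hL' => ?_, ?_, fun L M L' M' h h' => h.existsUnique_smul_eq hq hσ hB hB0 h'⟩
  · obtain ⟨M, h⟩ := hL.exists_sextuple hq hσ hB hl
    obtain ⟨M', h'⟩ := hL'.exists_sextuple hq hσ hB hl
    obtain ⟨g, ⟨hg, hgL, -⟩, -⟩ := h.existsUnique_smul_eq hq hσ hB hB0 h'
    exact ⟨g, hg, hgL⟩
  · obtain ⟨P, hP, hP', hPB⟩ := exists_skew_isotropic_planes hq hσ B (by simp) hl hr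
    exact ⟨_, (isSkewTriple_projPoints hB hP hP' hPB).exists_sextuple hq hσ hB hl⟩
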